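/- **Model.** Let $\alpha,\beta,h\ge 0$ and let $J$ be a real random variable with symmetric distribution ($J$ and $-J$ have the same law) and $\mathbb E|J|<\infty$. For an integer $K\ge1$ and $\zeta\ge 0$ let $P_\zeta$ be a Poisson variable of mean $\zeta$, let $(J_\nu)_{\nu\ge1}$ be independent copies of $J$, and let $(j_\nu)$, $(k_\nu)$ be independent and uniformly distributed on $\{1,\dots,K\}$, all of these variables being independent. For $\sigma\in\{-1,1\}^K$ put $$H_K(\sigma,\alpha)=-\sum_{\nu=1}^{P_{\alpha K}}J_\nu\sigma_{j_\nu}\sigma_{k_\nu},\qquad H_K^{ext}(\sigma)=-h\sum_{j=1}^K\sigma_j,\qquad Z_K=\sum_{\sigma}e^{-\beta(H_K(\sigma,\alpha)+H^{ext}_K(\sigma))},$$ and, for $\beta>0$, define the free energy per site $f_K$ by $-\beta f_K=\frac1K\mathbb E\ln Z_K$. **Interpolation.** For integers $N,M\ge1$, $t\in[0,1]$ and $\rho=(\tau,\sigma)\in\{-1,1\}^{N}\times\{-1,1\}^{M}$, let $$H(t)(\rho)=H_{N+M}(\rho,t\alpha)+H_N(\tau,(1-t)\alpha)+H_M(\sigma,(1-t)\alpha)+H^{ext}_{N+M}(\rho),$$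 where the three random Hamiltonians are independent, and let $\Phi_t=\mathbb E\ln\sum_\rho e^{-\beta H(t)(\rho)}$. For a function $O$ of $m$ configurations (replicas) $\rho^{(1)},\dots,\rho^{(m)}$ let $\langle O\rangle_t$ be the expectation over the quenched variables of the average of $O$ under the product of $m$ copies of the Gibbs measure with weights proportional to $e^{-\beta H(t)}$, all with the same quenched variables. Write $$q_m=\frac1N\sum_{i=1}^N\tau_i^{(1)}\cdots\tau_i^{(m)},\qquad \tilde q_m=\frac1M\sum_{j=1}^M\sigma_j^{(1)}\cdots\sigma_j^{(m)},$$ $$B_{n,t}=\frac1{N+M}\big\langle (q_{2n}N)^2+2q_{2n}N\,\tilde q_{2n}M+(\tilde q_{2n}M)^2\big\rangle_t-\big\langle q_{2n}^2N+\tilde q_{2n}^2M\big\rangle_t .$$ **Theorem.** All the expectations $\mathbb E\ln Z_K$, $\Phi_t$ and $\langle O\rangle_t$ above exist (the variables are integrable), and the following hold. 1. For all $N,M\ge1$: $\Phi_0=\mathbb E\ln Z_N+\mathbb E\ln Z_M$ and $\Phi_1=\mathbb E\ln Z_{N+M}$. The function $\Phi$ is differentiable on $[0,1]$ (one-sidedly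 at the end points), and for every $t\in[0,1]$, with convergent series, $$\frac{d}{dt}\Phi_t=-\alpha\sum_{n=1}^\infty\frac{\mathbb E\tanh^{2n}(\beta J)}{2n}B_{n,t}=\alpha\sum_{n=1}^\infty\frac1{2n}\,\mathbb E\tanh^{2n}(\beta J)\,\frac{NM}{N+M}\big\langle(q_{2n}-\tilde q_{2n})^2\big\rangle_t\ \ge 0,$$ where $B_{n,t}=-\frac{NM}{N+M}\langle(q_{2n}-\tilde q_{2n})^2\rangle_t\le0$ for every $n\ge1$. 2. For all $N,M\ge1$: $\mathbb E\ln Z_{N+M}\ge\mathbb E\ln Z_N+\mathbb E\ln Z_M$. 3. The limit $\lim_{K\to\infty}\frac1K\mathbb E\ln Z_K=p$ exists and is finite; hence, if $\beta>0$, the free energy per site converges: $\lim_{K\to\infty}f_K=-p/\beta$. -/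

import Mathlib

open MeasureTheory ProbabilityTheory Filter Topology Set

noncomputable section

namespace VianaBray

/-- Spin configurations on `K` sites; each spin is `1` or `-1`. -/
abbrev Config (K : ℕ) : Type := Fin K → ℤˣ

/-- The spin at site `i`, as a real number. -/
def spin {K : ℕ} (σ : Config K) (i : Fin K) : ℝ := ((σ i : ℤ) : ℝ)

/-- A realization of the quenched variables of a `K`-site Hamiltonian: the number `P` of
interaction terms, and for each `ν` the coupling `J_ν` with its pair of sites `(j_ν, k_ν)`. -/
abbrev Disorder (K : ℕ) : Type := ℕ × (ℕ → ℝ × Fin K × Fin K)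

/-- The uniform distribution on the `K` sites. -/
def uniformSite (K : ℕ) [NeZero K] : Measure (Fin K) :=
  (PMF.uniformOfFintype (Fin K)).toMeasure

instance (K : ℕ) [NeZero K] : IsProbabilityMeasure (uniformSite K) := by
  unfold uniformSite; infer_instance

/-- The law of the quenched variables: a Poisson variable of mean `ζ` and, independently of it,
an i.i.d. sequence of triples of independent variables, the coupling with law `μ` and the two
sites uniform. -/
def disorderLaw (μ : Measure ℝ) [IsProbabilityMeasure μ] (K : ℕ) [NeZero K] (ζ : ℝ) :
    Measure (Disorder K) :=
  (poissonMeasure ζ.toNNReal).prod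
    (Measure.infinitePi fun _ : ℕ => μ.prod ((uniformSite K).prod (uniformSite K)))

/-- The Hamiltonian `-∑_{ν = 1}^{P} J_ν σ_{j_ν} σ_{k_ν}` (the couplings are numbered from `0`). -/
def hamiltonian {K : ℕ} (ω : Disorder K) (σ : Config K) : ℝ :=
  -∑ ν ∈ Finset.range ω.1, (ω.2 ν).1 * spin σ (ω.2 ν).2.1 * spin σ (ω.2 ν).2.2

/-- The energy `-h ∑_j σ_j` of the external field. -/
def extHamiltonian {K : ℕ} (h : ℝ) (σ : Config K) : ℝ := -h * ∑ j, spin σ j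

/-- The partition function. -/
def partitionFn {K : ℕ} (β h : ℝ) (ω : Disorder K) : ℝ :=
  ∑ σ : Config K, Real.exp (-β * (hamiltonian ω σ + extHamiltonian h σ))

/-- `𝔼 ln Z_K(β, α, h)`; the number of interaction terms has mean `α K`. -/
def meanLogZ (μ : Measure ℝ) [IsProbabilityMeasure μ] (α β h : ℝ) (K : ℕ) [NeZero K] : ℝ :=
  ∫ ω, Real.log (partitionFn β h ω) ∂(disorderLaw μ K (α * K))

/-- The free energy per site: `-β f_K = (1/K) 𝔼 ln Z_K` (meaningful for `β ≠ 0`). -/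
def freeEnergy (μ : Measure ℝ) [IsProbabilityMeasure μ] (α β h : ℝ) (K : ℕ) [NeZero K] : ℝ :=
  -(1 / β) * (meanLogZ μ α β h K / K)

/-- The configuration of the first `N` spins (the cavity). -/
def cavity {N M : ℕ} (ρ : Config (N + M)) : Config N := fun i => ρ (Fin.castAdd M i)

/-- The configuration of the last `M` spins (the added ones). -/
def added {N M : ℕ} (ρ : Config (N + M)) : Config M := fun j => ρ (Fin.natAdd N j)

/-- The quenched variables of the three Hamiltonians `H_{N+M}`, `H_N`, `H_M`. -/
abbrev InterpDisorder (N M : ℕ) : Type := Disorder (N + M) × Disorder N × Disorder M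

/-- The law of the quenched variables of `H_{N+M}(tα)`, `H_N((1-t)α)`, `H_M((1-t)α)`, the three
Hamiltonians being independent. -/
def interpLaw (μ : Measure ℝ) [IsProbabilityMeasure μ] (N M : ℕ) [NeZero N] [NeZero M]
    (α t : ℝ) : Measure (InterpDisorder N M) :=
  (disorderLaw μ (N + M) (t * α * (N + M : ℕ))).prod
    ((disorderLaw μ N ((1 - t) * α * N)).prod (disorderLaw μ M ((1 - t) * α * M)))

/-- The interpolating Hamiltonian `H_{N+M} + H_N + H_M`, plus the external field. -/
def interpHamiltonian {N M : ℕ} (h : ℝ) (ω : InterpDisorder N M) (ρ : Config (N + M)) : ℝ :=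
  hamiltonian ω.1 ρ + hamiltonian ω.2.1 (cavity ρ) + hamiltonian ω.2.2 (added ρ)
    + extHamiltonian h ρ

/-- The partition function of the interpolating Hamiltonian. -/
def interpZ {N M : ℕ} (β h : ℝ) (ω : InterpDisorder N M) : ℝ :=
  ∑ ρ : Config (N + M), Real.exp (-β * interpHamiltonian h ω ρ)

/-- The interpolating function `Φ_t`. -/
def Phi (μ : Measure ℝ) [IsProbabilityMeasure μ] (N M : ℕ) [NeZero N] [NeZero M]
    (α β h t : ℝ) : ℝ :=
  ∫ ω, Real.log (interpZ β h ω) ∂(interpLaw μ N M α t)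

/-- The replicated Gibbs average `Ω` of an observable of `m` replicas: the average over the
product of `m` copies of the Gibbs measure of the interpolating Hamiltonian, all with the same
quenched variables. -/
def replicaGibbs {N M m : ℕ} (β h : ℝ) (ω : InterpDisorder N M)
    (O : (Fin m → Config (N + M)) → ℝ) : ℝ :=
  ∑ ρ : Fin m → Config (N + M),
    O ρ * ∏ a, (Real.exp (-β * interpHamiltonian h ω (ρ a)) / interpZ β h ω)

/-- `⟨O⟩_t = 𝔼 Ω(O)`. -/
def bracket (μ : Measure ℝ) [IsProbabilityMeasure μ] {N M m : ℕ} [NeZero N] [NeZero M]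
    (α β h t : ℝ) (O : (Fin m → Config (N + M)) → ℝ) : ℝ :=
  ∫ ω, replicaGibbs β h ω O ∂(interpLaw μ N M α t)

/-- The multi-overlap of `m` replicas on `K` sites. -/
def multiOverlap {K m : ℕ} (σ : Fin m → Config K) : ℝ :=
  (1 / (K : ℝ)) * ∑ i, ∏ a, spin (σ a) i

/-- The multi-overlap `q_m` of the cavity spins. -/
def q {N M m : ℕ} (ρ : Fin m → Config (N + M)) : ℝ := multiOverlap fun a => cavity (ρ a)

/-- The multi-overlap `q̃_m` of the added spins. -/
def qTilde {N M m : ℕ} (ρ : Fin m → Config (N + M)) : ℝ := multiOverlap fun a => added (ρ a)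

/-- `B_{n,t} = (1/(N+M)) ⟨(q_{2n} N)² + 2 q_{2n} N q̃_{2n} M + (q̃_{2n} M)²⟩_t
- ⟨q_{2n}² N + q̃_{2n}² M⟩_t`. -/
def B (μ : Measure ℝ) [IsProbabilityMeasure μ] (N M : ℕ) [NeZero N] [NeZero M]
    (α β h : ℝ) (n : ℕ) (t : ℝ) : ℝ :=
  1 / ((N : ℝ) + M) *
      bracket μ α β h t (fun ρ : Fin (2 * n) → Config (N + M) =>
        (q ρ * N) ^ 2 + 2 * (q ρ * N) * (qTilde ρ * M) + (qTilde ρ * M) ^ 2)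
    - bracket μ α β h t (fun ρ : Fin (2 * n) → Config (N + M) =>
        q ρ ^ 2 * N + qTilde ρ ^ 2 * M)

/-- The multi-overlap distance `⟨(q_{2n} - q̃_{2n})²⟩_t`. -/
def overlapDist (μ : Measure ℝ) [IsProbabilityMeasure μ] (N M : ℕ) [NeZero N] [NeZero M]
    (α β h : ℝ) (n : ℕ) (t : ℝ) : ℝ :=
  bracket μ α β h t (fun ρ : Fin (2 * n) → Config (N + M) => (q ρ - qTilde ρ) ^ 2)

/-- `𝔼 tanh^{2n}(β J)`. -/
def tanhMoment (μ : Measure ℝ) (β : ℝ) (n : ℕ) : ℝ := ∫ x, Real.tanh (β * x) ^ (2 * n) ∂μ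

end VianaBray

end

/-! Conditioning on the three numbers of links writes `Phi` as a triple Poisson series with
coefficients `fixedCountPhi`, independent of `t`; only the Poisson means depend on `t`, and they are
affine. Since the derivative in r of the weight of k is the weight of k - 1 minus the weight of k,
the derivative of `Phi` is the Poisson average of the increments of `fixedCountPhi`
(`hasDerivAt_tsum_poissonWeight3`). Such an increment is the mean effect on ln Z of one more random
link (`fixedCountPhi_sub`).

A link J between sites i and j changes ln Z by ln(cosh βJ + w sinh βJ), where w is the Gibbs average
of the product of the two spins (`log_linkedZ_sub`). Averaging over J and -J leaves ln cosh βJ +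
(1/2) ln(1 - w² tanh² βJ), a series in even powers of w. Averaging w^{2n} over uniform sites gives
the replica average of a squared multi-overlap (`replicaGibbs_siteOverlap_sq`).

The three kinds of links enter with rates α(N+M), -αN and -αM, which sum to zero, so the ln cosh
terms cancel. What remains is the series of the `B` terms, and the identity (Nq + Mq̃)²/(N+M) - Nq²
- Mq̃² = -NM/(N+M) (q - q̃)² gives its sign. Hence `Phi` increases from the decoupled system to the
joint one. This is superadditivity of 𝔼 ln Z, and Fekete's lemma with a linear upper bound gives the
limit. -/

noncomputable section
namespace VianaBray

/-! ### Poisson weights and differentiation of Poisson averages -/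

/-- The Poisson weight `e^{-r} r^k / k!`, for every real `r`. -/
def poissonWeight (r : ℝ) (k : ℕ) : ℝ := Real.exp (-r) * (r ^ k / (k.factorial : ℝ))

/-- The Poisson weight of the predecessor, `0` at `0`. -/
def poissonWeightPred (r : ℝ) : ℕ → ℝ
  | 0 => 0
  | k + 1 => poissonWeight r k

/-- Negative r is allowed so that the series can be differentiated on an open interval around any
time, end points of [0,1] included. -/
theorem hasDerivAt_poissonWeight (r : ℝ) (k : ℕ) :
    HasDerivAt (fun s => poissonWeight s k) (poissonWeightPred r k - poissonWeight r k) r := by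
  have he : HasDerivAt (fun s : ℝ => Real.exp (-s)) (-Real.exp (-r)) r := by
    simpa using (hasDerivAt_neg r).exp
  have hp : HasDerivAt (fun s : ℝ => s ^ k / (k.factorial : ℝ))
      (k * r ^ (k - 1) / (k.factorial : ℝ)) r := (hasDerivAt_pow k r).div_const _
  have := he.mul hp
  refine this.congr_deriv ?_
  cases k with
  | zero => simp [poissonWeight, poissonWeightPred]
  | succ k =>
    have h1 : ((k : ℝ) + 1) ≠ 0 := by positivity
    have h2 : (k.factorial : ℝ) ≠ 0 := by positivity
    simp only [poissonWeight, poissonWeightPred, Nat.factorial_succ, Nat.cast_mul, Nat.cast_add,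
      Nat.cast_one, Nat.add_sub_cancel]
    field_simp
    ring

theorem abs_poissonWeight_le {r R : ℝ} (hr : |r| ≤ R) (k : ℕ) :
    |poissonWeight r k| ≤ Real.exp R * ((2 * R) ^ k / (k.factorial : ℝ)) := by
  have hR : 0 ≤ R := (abs_nonneg r).trans hr
  unfold poissonWeight
  rw [abs_mul, abs_div, abs_pow, Real.abs_exp, Nat.abs_cast]
  gcongr
  · exact (neg_le_abs r).trans hr
  · linarith

/-- At k + 1 the derivative is the weight with one factor r replaced by k + 1 - r, and |k + 1 - r| ≤
2^(k+1) R when R ≥ 1. This is the origin of the base 2R, which the bound on the weight itself shares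
so that one majorant serves both. -/
theorem abs_poissonWeight_deriv_le {r R : ℝ} (hR : 1 ≤ R) (hr : |r| ≤ R) (k : ℕ) :
    |poissonWeightPred r k - poissonWeight r k|
      ≤ Real.exp R * ((2 * R) ^ k / (k.factorial : ℝ)) := by
  have he : Real.exp (-r) ≤ Real.exp R := Real.exp_le_exp.2 ((neg_le_abs r).trans hr)
  cases k with
  | zero => simpa [poissonWeightPred, poissonWeight] using he
  | succ k =>
    have h1 : poissonWeightPred r (k + 1) - poissonWeight r (k + 1)
        = Real.exp (-r) * (r ^ k * ((k + 1) - r) / ((k + 1).factorial : ℝ)) := by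
      have h2 : (k.factorial : ℝ) ≠ 0 := by positivity
      simp only [poissonWeight, poissonWeightPred, Nat.factorial_succ, Nat.cast_mul, Nat.cast_add,
        Nat.cast_one]
      field_simp
      ring
    rw [h1, abs_mul, abs_div, abs_mul, abs_pow, Real.abs_exp, Nat.abs_cast]
    have h3 : |(k : ℝ) + 1 - r| ≤ 2 ^ (k + 1) * R := by
      have h4 : ((k : ℝ) + 1) + 1 ≤ 2 ^ (k + 1) := by
        exact_mod_cast (Nat.lt_two_pow_self : k + 1 < 2 ^ (k + 1))
      have h5 : |(k : ℝ) + 1 - r| ≤ (k + 1) + R := by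
        refine (abs_sub _ _).trans ?_
        rw [abs_of_nonneg (by positivity : (0 : ℝ) ≤ k + 1)]
        linarith
      nlinarith [Nat.cast_nonneg (α := ℝ) k]
    have h6 : |r| ^ k * |(k : ℝ) + 1 - r| ≤ (2 * R) ^ (k + 1) := by
      calc |r| ^ k * |(k : ℝ) + 1 - r| ≤ R ^ k * (2 ^ (k + 1) * R) := by gcongr
        _ = (2 * R) ^ (k + 1) := by rw [mul_pow]; ring
    gcongr

/-- The product of three Poisson weights. -/
def poissonWeight3 (r : ℝ × ℝ × ℝ) (i : ℕ × ℕ × ℕ) : ℝ :=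
  poissonWeight r.1 i.1 * poissonWeight r.2.1 i.2.1 * poissonWeight r.2.2 i.2.2

/-- The majorant of products of three Poisson weights. -/
def poissonMajorant (R : ℝ) (i : ℕ × ℕ × ℕ) : ℝ :=
  (Real.exp R * ((2 * R) ^ i.1 / (i.1.factorial : ℝ))) *
  (Real.exp R * ((2 * R) ^ i.2.1 / (i.2.1.factorial : ℝ))) *
  (Real.exp R * ((2 * R) ^ i.2.2 / (i.2.2.factorial : ℝ)))

/-- The growth `2^a 2^b 2^c`. -/
def expGrowth (i : ℕ × ℕ × ℕ) : ℝ := 2 ^ i.1 * 2 ^ i.2.1 * 2 ^ i.2.2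

theorem summable_poissonMajorant {R : ℝ} (hR : 0 ≤ R) :
    Summable fun i => poissonMajorant R i * expGrowth i := by
  have h : Summable fun k : ℕ => Real.exp R * ((4 * R) ^ k / (k.factorial : ℝ)) :=
    (Real.summable_pow_div_factorial (4 * R)).mul_left _
  have h0 : ∀ k : ℕ, 0 ≤ Real.exp R * ((4 * R) ^ k / (k.factorial : ℝ)) := fun k => by positivity
  have h2 := h.mul_of_nonneg h h0 h0
  have h3 := h.mul_of_nonneg h2 h0 (fun i => mul_nonneg (h0 _) (h0 _))
  refine h3.congr fun i => ?_
  have e : ∀ k : ℕ, (4 * R) ^ k = (2 * R) ^ k * 2 ^ k := fun k => by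
    rw [← mul_pow]; ring
  simp only [poissonMajorant, expGrowth, e]
  ring

theorem summable_poissonWeight3_mul {F : ℕ × ℕ × ℕ → ℝ} {C : ℝ}
    (hF : ∀ i, |F i| ≤ C * expGrowth i) (r : ℝ × ℝ × ℝ) :
    Summable fun i => poissonWeight3 r i * F i := by
  set R := max |r.1| (max |r.2.1| |r.2.2|)
  have hR : 0 ≤ R := (abs_nonneg _).trans (le_max_left _ _)
  refine Summable.of_norm_bounded ((summable_poissonMajorant hR).mul_left C) fun i => ?_
  rw [Real.norm_eq_abs, poissonWeight3, abs_mul, abs_mul, abs_mul, poissonMajorant]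
  have h1 := abs_poissonWeight_le (le_max_left _ _ : |r.1| ≤ R) i.1
  have h2 := abs_poissonWeight_le
    ((le_max_left _ _).trans (le_max_right _ _) : |r.2.1| ≤ R) i.2.1
  have h3 := abs_poissonWeight_le
    ((le_max_right _ _).trans (le_max_right _ _) : |r.2.2| ≤ R) i.2.2
  calc _ ≤ poissonMajorant R i * (C * expGrowth i) := by
        unfold poissonMajorant
        have := hF i
        gcongr
    _ = _ := by simp only [poissonMajorant]; ring

/-- The coefficients of interest grow only linearly in the counts. The cruder growth in powers of
two is convenient because an increment multiplies it by exactly 2, so the bound survives shifts. -/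
theorem abs_comp_le_expGrowth {F : ℕ × ℕ × ℕ → ℝ} {C : ℝ} (hF : ∀ i, |F i| ≤ C * expGrowth i)
    (e : ℕ × ℕ × ℕ → ℕ × ℕ × ℕ) (he : ∀ i, expGrowth (e i) = 2 * expGrowth i) (i : ℕ × ℕ × ℕ) :
    |F (e i)| ≤ (2 * C) * expGrowth i := by
  have := hF (e i)
  rw [he] at this
  linarith

/-- Summation by parts: a shift of the weights is moved onto the coefficients, because the shifted
weights vanish off the range of `e`. -/
theorem hasSum_shift {F w w' : ℕ × ℕ × ℕ → ℝ} {e : ℕ × ℕ × ℕ → ℕ × ℕ × ℕ} {S : ℝ}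
    (he : Function.Injective e) (h1 : ∀ i, w' (e i) = w i) (h0 : ∀ i, i ∉ range e → w' i = 0)
    (hs : HasSum (fun i => w i * F (e i)) S) : HasSum (fun i => w' i * F i) S := by
  rw [← he.hasSum_iff (fun i hi => by rw [h0 i hi, zero_mul])]
  simpa only [Function.comp_def, h1] using hs

/-- Increment of the first count. -/
def incFst (i : ℕ × ℕ × ℕ) : ℕ × ℕ × ℕ := (i.1 + 1, i.2.1, i.2.2)

/-- Increment of the second count. -/
def incSnd (i : ℕ × ℕ × ℕ) : ℕ × ℕ × ℕ := (i.1, i.2.1 + 1, i.2.2)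

/-- Increment of the third count. -/
def incThd (i : ℕ × ℕ × ℕ) : ℕ × ℕ × ℕ := (i.1, i.2.1, i.2.2 + 1)

theorem expGrowth_incFst (i : ℕ × ℕ × ℕ) : expGrowth (incFst i) = 2 * expGrowth i := by
  simp only [expGrowth, incFst, pow_succ]; ring

theorem expGrowth_incSnd (i : ℕ × ℕ × ℕ) : expGrowth (incSnd i) = 2 * expGrowth i := by
  simp only [expGrowth, incSnd, pow_succ]; ring

theorem expGrowth_incThd (i : ℕ × ℕ × ℕ) : expGrowth (incThd i) = 2 * expGrowth i := by
  simp only [expGrowth, incThd, pow_succ]; ring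

theorem hasSum_poissonWeightPred_fst {F : ℕ × ℕ × ℕ → ℝ} {C : ℝ}
    (hF : ∀ i, |F i| ≤ C * expGrowth i) (r : ℝ × ℝ × ℝ) :
    HasSum (fun i : ℕ × ℕ × ℕ => poissonWeightPred r.1 i.1 * poissonWeight r.2.1 i.2.1 *
      poissonWeight r.2.2 i.2.2 * F i) (∑' i, poissonWeight3 r i * F (incFst i)) := by
  refine hasSum_shift (e := incFst) ?_ (fun i => rfl) ?_
    (summable_poissonWeight3_mul (abs_comp_le_expGrowth hF _ expGrowth_incFst) r).hasSum
  · rintro ⟨a, b, c⟩ ⟨a', b', c'⟩ h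
    simpa [incFst] using h
  · rintro ⟨_ | a, b, c⟩ h
    · simp [poissonWeightPred]
    · exact absurd ⟨(a, b, c), rfl⟩ h

theorem hasSum_poissonWeightPred_snd {F : ℕ × ℕ × ℕ → ℝ} {C : ℝ}
    (hF : ∀ i, |F i| ≤ C * expGrowth i) (r : ℝ × ℝ × ℝ) :
    HasSum (fun i : ℕ × ℕ × ℕ => poissonWeight r.1 i.1 * poissonWeightPred r.2.1 i.2.1 *
      poissonWeight r.2.2 i.2.2 * F i) (∑' i, poissonWeight3 r i * F (incSnd i)) := by
  refine hasSum_shift (e := incSnd) ?_ (fun i => rfl) ?_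
    (summable_poissonWeight3_mul (abs_comp_le_expGrowth hF _ expGrowth_incSnd) r).hasSum
  · rintro ⟨a, b, c⟩ ⟨a', b', c'⟩ h
    simpa [incSnd] using h
  · rintro ⟨a, _ | b, c⟩ h
    · simp [poissonWeightPred]
    · exact absurd ⟨(a, b, c), rfl⟩ h

theorem hasSum_poissonWeightPred_thd {F : ℕ × ℕ × ℕ → ℝ} {C : ℝ}
    (hF : ∀ i, |F i| ≤ C * expGrowth i) (r : ℝ × ℝ × ℝ) :
    HasSum (fun i : ℕ × ℕ × ℕ => poissonWeight r.1 i.1 * poissonWeight r.2.1 i.2.1 *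
      poissonWeightPred r.2.2 i.2.2 * F i) (∑' i, poissonWeight3 r i * F (incThd i)) := by
  refine hasSum_shift (e := incThd) ?_ (fun i => rfl) ?_
    (summable_poissonWeight3_mul (abs_comp_le_expGrowth hF _ expGrowth_incThd) r).hasSum
  · rintro ⟨a, b, c⟩ ⟨a', b', c'⟩ h
    simpa [incThd] using h
  · rintro ⟨a, b, _ | c⟩ h
    · simp [poissonWeightPred]
    · exact absurd ⟨(a, b, c), rfl⟩ h

/-- The derivative of `poissonWeight3` along the direction `y`. -/
def poissonWeight3Deriv (y r : ℝ × ℝ × ℝ) (i : ℕ × ℕ × ℕ) : ℝ :=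
  y.1 * ((poissonWeightPred r.1 i.1 - poissonWeight r.1 i.1) *
      poissonWeight r.2.1 i.2.1 * poissonWeight r.2.2 i.2.2) +
    y.2.1 * (poissonWeight r.1 i.1 * (poissonWeightPred r.2.1 i.2.1 - poissonWeight r.2.1 i.2.1) *
      poissonWeight r.2.2 i.2.2) +
    y.2.2 * (poissonWeight r.1 i.1 * poissonWeight r.2.1 i.2.1 *
      (poissonWeightPred r.2.2 i.2.2 - poissonWeight r.2.2 i.2.2))

theorem hasDerivAt_poissonWeight3 (x y : ℝ × ℝ × ℝ) (i : ℕ × ℕ × ℕ) (t : ℝ) :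
    HasDerivAt (fun s : ℝ => poissonWeight3 (x + s • y) i)
      (poissonWeight3Deriv y (x + t • y) i) t := by
  have key : ∀ (a b : ℝ) (k : ℕ), HasDerivAt (fun s : ℝ => poissonWeight (a + s * b) k)
      ((poissonWeightPred (a + t * b) k - poissonWeight (a + t * b) k) * b) t := fun a b k => by
    have h : HasDerivAt (fun s : ℝ => a + s * b) b t := by
      simpa using ((hasDerivAt_id t).mul_const b).const_add a
    exact (hasDerivAt_poissonWeight (a + t * b) k).comp t h
  refine (((key x.1 y.1 i.1).mul (key x.2.1 y.2.1 i.2.1)).mul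
    (key x.2.2 y.2.2 i.2.2)).congr_deriv ?_
  simp only [poissonWeight3Deriv, Prod.fst_add, Prod.snd_add, Prod.smul_fst, Prod.smul_snd,
    smul_eq_mul, Pi.mul_apply]
  ring

theorem abs_poissonWeight3Deriv_le {y r : ℝ × ℝ × ℝ} {R : ℝ} (hR : 1 ≤ R) (h1 : |r.1| ≤ R)
    (h2 : |r.2.1| ≤ R) (h3 : |r.2.2| ≤ R) (i : ℕ × ℕ × ℕ) :
    |poissonWeight3Deriv y r i| ≤ (|y.1| + |y.2.1| + |y.2.2|) * poissonMajorant R i := by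
  have a1 := abs_poissonWeight_le h1 i.1
  have a2 := abs_poissonWeight_le h2 i.2.1
  have a3 := abs_poissonWeight_le h3 i.2.2
  have b1 := abs_poissonWeight_deriv_le hR h1 i.1
  have b2 := abs_poissonWeight_deriv_le hR h2 i.2.1
  have b3 := abs_poissonWeight_deriv_le hR h3 i.2.2
  unfold poissonWeight3Deriv
  refine (abs_add_le _ _).trans ?_
  rw [add_mul]
  refine add_le_add ((abs_add_le _ _).trans ?_) ?_
  · rw [add_mul]
    refine add_le_add ?_ ?_ <;>
    · simp only [abs_mul]
      unfold poissonMajorant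
      gcongr
  · simp only [abs_mul]
    unfold poissonMajorant
    gcongr

/-- A Poisson average in three counts is differentiable along lines of the parameters, and its
derivative is the Poisson average of the increments. -/
theorem hasDerivAt_tsum_poissonWeight3 {F : ℕ × ℕ × ℕ → ℝ} {C : ℝ}
    (hF : ∀ i, |F i| ≤ C * expGrowth i) (x y : ℝ × ℝ × ℝ) (t : ℝ) :
    HasDerivAt (fun s : ℝ => ∑' i, poissonWeight3 (x + s • y) i * F i)
      (∑' i, poissonWeight3 (x + t • y) i * (y.1 * (F (incFst i) - F i) +
        y.2.1 * (F (incSnd i) - F i) + y.2.2 * (F (incThd i) - F i))) t := by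
  set r := x + t • y with hr
  have hsum : ∑' i, poissonWeight3Deriv y r i * F i =
      ∑' i, poissonWeight3 r i * (y.1 * (F (incFst i) - F i) +
        y.2.1 * (F (incSnd i) - F i) + y.2.2 * (F (incThd i) - F i)) := by
    have h0 := (summable_poissonWeight3_mul hF r).hasSum
    have s1 := (summable_poissonWeight3_mul (abs_comp_le_expGrowth hF _ expGrowth_incFst) r).hasSum
    have s2 := (summable_poissonWeight3_mul (abs_comp_le_expGrowth hF _ expGrowth_incSnd) r).hasSum
    have s3 := (summable_poissonWeight3_mul (abs_comp_le_expGrowth hF _ expGrowth_incThd) r).hasSum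
    have hl := ((((hasSum_poissonWeightPred_fst hF r).sub h0).mul_left y.1).add
      (((hasSum_poissonWeightPred_snd hF r).sub h0).mul_left y.2.1)).add
      (((hasSum_poissonWeightPred_thd hF r).sub h0).mul_left y.2.2)
    have hrr := (((s1.sub h0).mul_left y.1).add ((s2.sub h0).mul_left y.2.1)).add
      ((s3.sub h0).mul_left y.2.2)
    refine (tsum_congr fun i => ?_).trans
      (hl.tsum_eq.trans (hrr.tsum_eq.symm.trans (tsum_congr fun i => ?_)))
    · simp only [poissonWeight3Deriv, poissonWeight3]
      ring
    · ring
  rw [← hsum]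
  -- This bounds the three parameters for all times within distance 1 of `t`; the leading 1 provides
  -- the `1 ≤ R` needed for the derivative majorant.
  set R := 1 + (|x.1| + (|t| + 1) * |y.1|) + (|x.2.1| + (|t| + 1) * |y.2.1|) +
    (|x.2.2| + (|t| + 1) * |y.2.2|) with hRdef
  have p1 : 0 ≤ |x.1| + (|t| + 1) * |y.1| := by positivity
  have p2 : 0 ≤ |x.2.1| + (|t| + 1) * |y.2.1| := by positivity
  have p3 : 0 ≤ |x.2.2| + (|t| + 1) * |y.2.2| := by positivity
  have hb : ∀ a b s : ℝ, s ∈ Ioo (t - 1) (t + 1) → |a + s * b| ≤ |a| + (|t| + 1) * |b| := by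
    intro a b s hs
    refine (abs_add_le _ _).trans ?_
    rw [abs_mul]
    have : |s| ≤ |t| + 1 := by
      rw [abs_le]
      constructor
      · linarith [neg_abs_le t, hs.1]
      · linarith [le_abs_self t, hs.2]
    gcongr
  refine hasDerivAt_tsum_of_isPreconnected (y₀ := t) (t := Ioo (t - 1) (t + 1))
    (((summable_poissonMajorant (by linarith : (0 : ℝ) ≤ R)).mul_left
      ((|y.1| + |y.2.1| + |y.2.2|) * C))) isOpen_Ioo isPreconnected_Ioo
    (fun i s _ => (hasDerivAt_poissonWeight3 x y i s).mul_const (F i)) ?_ ?_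
    (summable_poissonWeight3_mul hF _) ?_
  · intro i s hs
    rw [Real.norm_eq_abs, abs_mul]
    have h1 := hb x.1 y.1 s hs
    have h2 := hb x.2.1 y.2.1 s hs
    have h3 := hb x.2.2 y.2.2 s hs
    have := abs_poissonWeight3Deriv_le (y := y) (r := x + s • y) (R := R) (by linarith)
      (h1.trans (by linarith)) (h2.trans (by linarith)) (h3.trans (by linarith)) i
    calc _ ≤ ((|y.1| + |y.2.1| + |y.2.2|) * poissonMajorant R i) * (C * expGrowth i) :=
          mul_le_mul this (hF i) (abs_nonneg _) ((abs_nonneg _).trans this)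
      _ = _ := by ring
  · constructor <;> linarith
  · constructor <;> linarith

/-! ### Laws of the counts and of the link sequences -/

theorem poissonMeasure_real_singleton_eq {r : ℝ} (hr : 0 ≤ r) (k : ℕ) :
    (poissonMeasure r.toNNReal).real {k} = poissonWeight r k := by
  rw [poissonMeasure_real_singleton, Real.coe_toNNReal _ hr, poissonWeight, mul_div_assoc]

/-- The law of three independent Poisson counts. -/
def countsLaw (r : ℝ × ℝ × ℝ) : Measure (ℕ × ℕ × ℕ) :=
  (poissonMeasure r.1.toNNReal).prod
    ((poissonMeasure r.2.1.toNNReal).prod (poissonMeasure r.2.2.toNNReal))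

instance (r : ℝ × ℝ × ℝ) : IsProbabilityMeasure (countsLaw r) := by
  unfold countsLaw; infer_instance

theorem integral_countsLaw {r : ℝ × ℝ × ℝ} (h1 : 0 ≤ r.1) (h2 : 0 ≤ r.2.1) (h3 : 0 ≤ r.2.2)
    {F : ℕ × ℕ × ℕ → ℝ} (hF : Integrable F (countsLaw r)) :
    ∫ i, F i ∂(countsLaw r) = ∑' i, poissonWeight3 r i * F i := by
  rw [integral_countable hF]
  refine tsum_congr fun i => ?_
  obtain ⟨a, b, c⟩ := i
  rw [countsLaw, ← singleton_prod_singleton, measureReal_prod_prod, ← singleton_prod_singleton,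
    measureReal_prod_prod, poissonMeasure_real_singleton_eq h1, poissonMeasure_real_singleton_eq h2,
    poissonMeasure_real_singleton_eq h3, poissonWeight3, smul_eq_mul]
  ring

theorem measurePreserving_prodProdProdComm {A B C D : Type*} [MeasurableSpace A]
    [MeasurableSpace B] [MeasurableSpace C] [MeasurableSpace D] (a : Measure A) (b : Measure B)
    (c : Measure C) (d : Measure D) [SFinite a] [SFinite b] [SFinite c] [SFinite d] :
    MeasurePreserving (fun p : (A × B) × (C × D) => ((p.1.1, p.2.1), (p.1.2, p.2.2)))
      ((a.prod b).prod (c.prod d)) ((a.prod c).prod (b.prod d)) := by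
  have h1 := measurePreserving_prodAssoc a b (c.prod d)
  have h2 := (measurePreserving_prodAssoc b c d).symm
  have h3 : MeasurePreserving (Prod.map Prod.swap id) ((b.prod c).prod d) ((c.prod b).prod d) :=
    Measure.measurePreserving_swap.prod (MeasurePreserving.id d)
  have h4 := measurePreserving_prodAssoc c b d
  have h5 := (MeasurePreserving.id a).prod ((h4.comp h3).comp h2)
  have h6 := (measurePreserving_prodAssoc a c (b.prod d)).symm
  exact (h6.comp h5).comp h1

/-- Overwriting one coordinate of an i.i.d. sequence by a fresh independent copy does not change the
law. This allows the newly added link to be integrated separately from the others. -/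
theorem measurePreserving_update {X : Type*} [MeasurableSpace X] (ν : Measure X)
    [IsProbabilityMeasure ν] (n : ℕ) :
    MeasurePreserving (fun p : (ℕ → X) × X => Function.update p.1 n p.2)
      ((Measure.infinitePi fun _ : ℕ => ν).prod ν) (Measure.infinitePi fun _ : ℕ => ν) := by
  have hm : Measurable (fun p : (ℕ → X) × X => Function.update p.1 n p.2) := by
    refine measurable_pi_iff.2 fun k => ?_
    by_cases hk : k = n
    · subst hk; simpa using measurable_snd
    · simp only [Function.update_of_ne hk]
      exact (measurable_pi_apply k).comp measurable_fst
  refine ⟨hm, Measure.eq_infinitePi _ fun s t ht => ?_⟩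
  rw [Measure.map_apply hm (.pi s.countable_toSet fun _ _ => ht _)]
  by_cases hn : n ∈ s
  · have e : (fun p : (ℕ → X) × X => Function.update p.1 n p.2) ⁻¹' (Set.pi s t)
        = (Set.pi (s.erase n : Finset ℕ) t) ×ˢ (t n) := by
      ext ⟨f, x⟩
      simp only [mem_preimage, Set.mem_pi, mem_prod, Finset.mem_coe, Finset.mem_erase]
      constructor
      · intro h
        refine ⟨fun i hi => ?_, by simpa using h n hn⟩
        simpa [Function.update_of_ne hi.1] using h i hi.2
      · rintro ⟨h1, h2⟩ i hi
        by_cases hin : i = n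
        · subst hin; simpa using h2
        · simpa [Function.update_of_ne hin] using h1 i ⟨hin, hi⟩
    rw [e, Measure.prod_prod, Measure.infinitePi_pi _ fun i _ => ht i,
      Finset.prod_erase_mul _ _ hn]
  · have e : (fun p : (ℕ → X) × X => Function.update p.1 n p.2) ⁻¹' (Set.pi s t)
        = (Set.pi s t) ×ˢ univ := by
      ext ⟨f, x⟩
      simp only [mem_preimage, Set.mem_pi, mem_prod, Finset.mem_coe, mem_univ, and_true]
      refine forall₂_congr fun i hi => ?_
      rw [Function.update_of_ne (fun h : i = n => hn (h ▸ hi))]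
    rw [e, Measure.prod_prod, Measure.infinitePi_pi _ fun i _ => ht i, measure_univ, mul_one]

/-- The law of one coupling with its pair of sites. -/
def linkLaw (μ : Measure ℝ) (K : ℕ) [NeZero K] : Measure (ℝ × Fin K × Fin K) :=
  μ.prod ((uniformSite K).prod (uniformSite K))

instance (μ : Measure ℝ) [IsProbabilityMeasure μ] (K : ℕ) [NeZero K] :
    IsProbabilityMeasure (linkLaw μ K) := by
  unfold linkLaw; infer_instance

/-- The law of the sequence of couplings with their pairs of sites. -/
def seqLaw (μ : Measure ℝ) [IsProbabilityMeasure μ] (K : ℕ) [NeZero K] :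
    Measure (ℕ → ℝ × Fin K × Fin K) :=
  Measure.infinitePi fun _ : ℕ => linkLaw μ K

instance (μ : Measure ℝ) [IsProbabilityMeasure μ] (K : ℕ) [NeZero K] :
    IsProbabilityMeasure (seqLaw μ K) := by
  unfold seqLaw; infer_instance

theorem disorderLaw_eq (μ : Measure ℝ) [IsProbabilityMeasure μ] (K : ℕ) [NeZero K] (ζ : ℝ) :
    disorderLaw μ K ζ = (poissonMeasure ζ.toNNReal).prod (seqLaw μ K) := rfl

instance (μ : Measure ℝ) [IsProbabilityMeasure μ] (K : ℕ) [NeZero K] (ζ : ℝ) :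
    IsProbabilityMeasure (disorderLaw μ K ζ) := by
  unfold disorderLaw; infer_instance

instance (μ : Measure ℝ) [IsProbabilityMeasure μ] (N M : ℕ) [NeZero N] [NeZero M] (α t : ℝ) :
    IsProbabilityMeasure (interpLaw μ N M α t) := by
  unfold interpLaw; infer_instance

/-- The three sequences of couplings with their sites. -/
abbrev Seq3 (N M : ℕ) : Type :=
  (ℕ → ℝ × Fin (N + M) × Fin (N + M)) × (ℕ → ℝ × Fin N × Fin N) × (ℕ → ℝ × Fin M × Fin M)

/-- The law of the three independent sequences. -/
def seq3Law (μ : Measure ℝ) [IsProbabilityMeasure μ] (N M : ℕ) [NeZero N] [NeZero M] :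
    Measure (Seq3 N M) :=
  (seqLaw μ (N + M)).prod ((seqLaw μ N).prod (seqLaw μ M))

instance (μ : Measure ℝ) [IsProbabilityMeasure μ] (N M : ℕ) [NeZero N] [NeZero M] :
    IsProbabilityMeasure (seq3Law μ N M) := by
  unfold seq3Law; infer_instance

/-- The quenched variables made of three counts and three sequences. -/
def zipDisorder {N M : ℕ} (p : (ℕ × ℕ × ℕ) × Seq3 N M) : InterpDisorder N M :=
  ((p.1.1, p.2.1), (p.1.2.1, p.2.2.1), (p.1.2.2, p.2.2.2))

/-- The means of the three counts at time `t`. -/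
def rates (N M : ℕ) (α t : ℝ) : ℝ × ℝ × ℝ :=
  (t * α * (N + M : ℕ), (1 - t) * α * N, (1 - t) * α * M)

/-- Regrouping the independent factors separates the counts, which carry all the dependence on `t`,
from the sequences of links. -/
theorem measurePreserving_zipDisorder (μ : Measure ℝ) [IsProbabilityMeasure μ] (N M : ℕ)
    [NeZero N] [NeZero M] (α t : ℝ) :
    MeasurePreserving (zipDisorder (N := N) (M := M))
      ((countsLaw (rates N M α t)).prod (seq3Law μ N M)) (interpLaw μ N M α t) := by
  have h1 := measurePreserving_prodProdProdComm
    (poissonMeasure (rates N M α t).1.toNNReal)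
    ((poissonMeasure (rates N M α t).2.1.toNNReal).prod
      (poissonMeasure (rates N M α t).2.2.toNNReal))
    (seqLaw μ (N + M)) ((seqLaw μ N).prod (seqLaw μ M))
  have h2 := measurePreserving_prodProdProdComm
    (poissonMeasure (rates N M α t).2.1.toNNReal)
    (poissonMeasure (rates N M α t).2.2.toNNReal) (seqLaw μ N) (seqLaw μ M)
  exact ((MeasurePreserving.id ((poissonMeasure (rates N M α t).1.toNNReal).prod
    (seqLaw μ (N + M)))).prod h2).comp h1

theorem integral_interpLaw {μ : Measure ℝ} [IsProbabilityMeasure μ] {N M : ℕ} [NeZero N]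
    [NeZero M] {α t : ℝ} {f : InterpDisorder N M → ℝ} (hf : Integrable f (interpLaw μ N M α t)) :
    Integrable (fun i => ∫ s, f (zipDisorder (i, s)) ∂(seq3Law μ N M))
      (countsLaw (rates N M α t)) ∧
    ∫ ω, f ω ∂(interpLaw μ N M α t) =
      ∫ i, ∫ s, f (zipDisorder (i, s)) ∂(seq3Law μ N M) ∂(countsLaw (rates N M α t)) := by
  have hp := measurePreserving_zipDisorder μ N M α t
  have hc := hp.integrable_comp_of_integrable hf
  refine ⟨hc.integral_prod_left, ?_⟩
  rw [← integral_prod (fun p => f (zipDisorder p)) hc, ← hp.map_eq, integral_map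
    hp.measurable.aemeasurable (by rw [hp.map_eq]; exact hf.aestronglyMeasurable)]

/-! ### Energy bounds, measurability and integrability of ln Z -/

theorem abs_spin {K : ℕ} (σ : Config K) (i : Fin K) : |spin σ i| = 1 := by
  unfold spin
  rcases Int.units_eq_one_or (σ i) with h | h <;> simp [h]

theorem spin_sq {K : ℕ} (σ : Config K) (i : Fin K) : spin σ i ^ 2 = 1 := by
  rw [← sq_abs, abs_spin, one_pow]

/-- The sum of the absolute values of the couplings. -/
def absCoupling {K : ℕ} (ω : Disorder K) : ℝ := ∑ ν ∈ Finset.range ω.1, |(ω.2 ν).1|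

theorem absCoupling_nonneg {K : ℕ} (ω : Disorder K) : 0 ≤ absCoupling ω :=
  Finset.sum_nonneg fun _ _ => abs_nonneg _

theorem abs_hamiltonian_le {K : ℕ} (ω : Disorder K) (σ : Config K) :
    |hamiltonian ω σ| ≤ absCoupling ω := by
  unfold hamiltonian absCoupling
  rw [abs_neg]
  refine (Finset.abs_sum_le_sum_abs _ _).trans (Finset.sum_le_sum fun ν _ => ?_)
  rw [abs_mul, abs_mul, abs_spin, abs_spin, mul_one, mul_one]

theorem abs_extHamiltonian_le {K : ℕ} {h : ℝ} (hh : 0 ≤ h) (σ : Config K) :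
    |extHamiltonian h σ| ≤ h * K := by
  unfold extHamiltonian
  rw [abs_mul, abs_neg, abs_of_nonneg hh]
  gcongr
  refine (Finset.abs_sum_le_sum_abs _ _).trans ?_
  simp [abs_spin]

theorem abs_interpHamiltonian_le {N M : ℕ} {h : ℝ} (hh : 0 ≤ h) (ω : InterpDisorder N M)
    (ρ : Config (N + M)) :
    |interpHamiltonian h ω ρ| ≤
      absCoupling ω.1 + absCoupling ω.2.1 + absCoupling ω.2.2 + h * (N + M : ℕ) := by
  unfold interpHamiltonian
  refine (abs_add_le _ _).trans (add_le_add ((abs_add_le _ _).trans (add_le_add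
    ((abs_add_le _ _).trans (add_le_add ?_ ?_)) ?_)) (abs_extHamiltonian_le hh ρ))
  all_goals exact abs_hamiltonian_le _ _

theorem measurable_hamiltonian {K : ℕ} (σ : Config K) :
    Measurable fun ω : Disorder K => hamiltonian ω σ := by
  refine measurable_from_prod_countable_right fun n => ?_
  have h : Measurable (spin σ) := Measurable.of_discrete
  have : Measurable fun s : ℕ → ℝ × Fin K × Fin K => ∑ ν ∈ Finset.range n,
      (s ν).1 * spin σ (s ν).2.1 * spin σ (s ν).2.2 := by fun_prop
  exact this.neg

theorem measurable_absCoupling {K : ℕ} : Measurable (absCoupling (K := K)) := by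
  refine measurable_from_prod_countable_right fun n => ?_
  exact Finset.measurable_sum (Finset.range n) fun ν _ =>
    (measurable_fst.comp (measurable_pi_apply ν)).abs

theorem measurable_interpHamiltonian {N M : ℕ} (h : ℝ) (ρ : Config (N + M)) :
    Measurable fun ω : InterpDisorder N M => interpHamiltonian h ω ρ := by
  unfold interpHamiltonian
  exact ((((measurable_hamiltonian ρ).comp measurable_fst).add
    ((measurable_hamiltonian _).comp (measurable_fst.comp measurable_snd))).add
    ((measurable_hamiltonian _).comp (measurable_snd.comp measurable_snd))).add_const _

theorem measurable_interpZ {N M : ℕ} (β h : ℝ) :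
    Measurable (interpZ β h : InterpDisorder N M → ℝ) := by
  unfold interpZ
  exact Finset.measurable_sum _ fun ρ _ => ((measurable_interpHamiltonian h ρ).const_mul _).exp

theorem measurable_partitionFn {K : ℕ} (β h : ℝ) :
    Measurable (partitionFn β h : Disorder K → ℝ) := by
  unfold partitionFn
  exact Finset.measurable_sum _ fun ρ _ =>
    (((measurable_hamiltonian ρ).add_const _).const_mul _).exp

theorem interpZ_pos {N M : ℕ} (β h : ℝ) (ω : InterpDisorder N M) : 0 < interpZ β h ω :=
  Finset.sum_pos (fun _ _ => Real.exp_pos _) Finset.univ_nonempty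

theorem partitionFn_pos {K : ℕ} (β h : ℝ) (ω : Disorder K) : 0 < partitionFn β h ω :=
  Finset.sum_pos (fun _ _ => Real.exp_pos _) Finset.univ_nonempty

/-- The sum lies between card · exp(-A) and card · exp A, and log card ≥ 0. -/
theorem abs_log_sum_exp_le {ι : Type*} [Fintype ι] [Nonempty ι] {u : ι → ℝ} {A : ℝ}
    (hu : ∀ i, |u i| ≤ A) :
    |Real.log (∑ i, Real.exp (u i))| ≤ Real.log (Fintype.card ι) + A := by
  have hc : (1 : ℝ) ≤ Fintype.card ι := by exact_mod_cast Fintype.card_pos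
  have hpos : 0 < ∑ i, Real.exp (u i) := Finset.sum_pos (fun _ _ => Real.exp_pos _)
    Finset.univ_nonempty
  have hlog : 0 ≤ Real.log (Fintype.card ι) := Real.log_nonneg hc
  have e : ∀ x : ℝ, Real.log (Fintype.card ι) + x =
      Real.log (∑ _i : ι, Real.exp x) := fun x => by
    rw [Finset.sum_const, Finset.card_univ, nsmul_eq_mul,
      Real.log_mul (by positivity) (Real.exp_ne_zero _), Real.log_exp]
  rw [abs_le]
  constructor
  · have : Real.log (Fintype.card ι) + -A ≤ Real.log (∑ i, Real.exp (u i)) := by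
      rw [e]
      refine Real.log_le_log (Finset.sum_pos (fun _ _ => Real.exp_pos _) Finset.univ_nonempty)
        (Finset.sum_le_sum fun i _ => Real.exp_le_exp.2 (abs_le.1 (hu i)).1)
    linarith
  · rw [e]
    exact Real.log_le_log hpos (Finset.sum_le_sum fun i _ => Real.exp_le_exp.2 (abs_le.1 (hu i)).2)

theorem log_card_config (K : ℕ) : Real.log (Fintype.card (Config K)) = K * Real.log 2 := by
  have : Fintype.card (Config K) = 2 ^ K := by simp [Config]
  rw [this]; push_cast; rw [Real.log_pow]

theorem abs_log_partitionFn_le {K : ℕ} {β h : ℝ} (hβ : 0 ≤ β) (hh : 0 ≤ h) (ω : Disorder K) :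
    |Real.log (partitionFn β h ω)| ≤ K * Real.log 2 + β * (absCoupling ω + h * K) := by
  rw [← log_card_config]
  refine abs_log_sum_exp_le fun σ => ?_
  rw [abs_mul, abs_neg, abs_of_nonneg hβ]
  gcongr
  exact (abs_add_le _ _).trans (add_le_add (abs_hamiltonian_le _ _) (abs_extHamiltonian_le hh _))

theorem abs_log_interpZ_le {N M : ℕ} {β h : ℝ} (hβ : 0 ≤ β) (hh : 0 ≤ h)
    (ω : InterpDisorder N M) :
    |Real.log (interpZ β h ω)| ≤ (N + M : ℕ) * Real.log 2 +
      β * (absCoupling ω.1 + absCoupling ω.2.1 + absCoupling ω.2.2 + h * (N + M : ℕ)) := by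
  rw [← log_card_config]
  refine abs_log_sum_exp_le fun ρ => ?_
  rw [abs_mul, abs_neg, abs_of_nonneg hβ]
  gcongr
  exact abs_interpHamiltonian_le hh _ _

theorem integrable_natCast_poissonMeasure (r : NNReal) :
    Integrable (fun n : ℕ => (n : ℝ)) (poissonMeasure r) := by
  rw [integrable_poissonMeasure_iff]
  have h := (Real.summable_pow_div_factorial ((2 : ℝ) * r)).mul_left (Real.exp (-r))
  refine h.of_nonneg_of_le (fun n => by positivity) fun n => ?_
  have hn : (n : ℝ) ≤ 2 ^ n := by exact_mod_cast Nat.lt_two_pow_self.le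
  rw [Real.norm_eq_abs, Nat.abs_cast, mul_pow, mul_div_assoc, mul_assoc]
  gcongr
  calc (r : ℝ) ^ n / (n.factorial : ℝ) * n ≤ (r : ℝ) ^ n / (n.factorial : ℝ) * 2 ^ n := by gcongr
    _ = _ := by ring

theorem integral_natCast_poissonMeasure (r : NNReal) :
    ∫ n : ℕ, (n : ℝ) ∂(poissonMeasure r) = r := by
  have h := hasSum_integral_poissonMeasure (integrable_natCast_poissonMeasure r)
  -- The term at 0 vanishes, and n + 1 cancels against (n + 1)!, leaving r times the total mass.
  rw [← hasSum_nat_add_iff' 1] at h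
  have h2 := (hasSum_one_poissonMeasure r).mul_left (r : ℝ)
  have := h.unique (h2.congr_fun fun n => ?_)
  · simpa using this
  · have h1 : ((n : ℝ) + 1) ≠ 0 := by positivity
    have h3 : (n.factorial : ℝ) ≠ 0 := by positivity
    simp only [Nat.factorial_succ, smul_eq_mul]
    push_cast
    field_simp
    ring

section
variable {μ : Measure ℝ} [IsProbabilityMeasure μ]

theorem integrable_coupling (hint : Integrable (fun x : ℝ => x) μ) (K : ℕ) [NeZero K] (ν : ℕ) :
    Integrable (fun s : ℕ → ℝ × Fin K × Fin K => |(s ν).1|) (seqLaw μ K) := by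
  have h1 : Integrable (fun x : ℝ × Fin K × Fin K => |x.1|) (linkLaw μ K) :=
    (hint.comp_fst _).abs
  exact (measurePreserving_eval_infinitePi (fun _ : ℕ => linkLaw μ K)
    ν).integrable_comp_of_integrable h1

theorem integral_coupling (hint : Integrable (fun x : ℝ => x) μ) (K : ℕ) [NeZero K] (ν : ℕ) :
    ∫ s : ℕ → ℝ × Fin K × Fin K, |(s ν).1| ∂(seqLaw μ K) = ∫ x, |x| ∂μ := by
  have h1 : Integrable (fun x : ℝ × Fin K × Fin K => |x.1|) (linkLaw μ K) :=
    (hint.comp_fst _).abs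
  have h := measurePreserving_eval_infinitePi (fun _ : ℕ => linkLaw μ K) ν
  have e := integral_map h.measurable.aemeasurable
    (f := fun x : ℝ × Fin K × Fin K => |x.1|) (by rw [h.map_eq]; exact h1.aestronglyMeasurable)
  rw [h.map_eq] at e
  refine e.symm.trans ?_
  unfold linkLaw
  rw [integral_fun_fst (fun x : ℝ => |x|)]
  simp

theorem integral_absCoupling_section (hint : Integrable (fun x : ℝ => x) μ) (K : ℕ) [NeZero K]
    (n : ℕ) : ∫ s, absCoupling (K := K) (n, s) ∂(seqLaw μ K) = n * ∫ x, |x| ∂μ := by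
  refine (integral_finsetSum (Finset.range n) fun ν _ => integrable_coupling hint K ν).trans ?_
  simp [integral_coupling hint]

theorem integrable_absCoupling_section (hint : Integrable (fun x : ℝ => x) μ) (K : ℕ) [NeZero K]
    (n : ℕ) : Integrable (fun s => absCoupling (K := K) (n, s)) (seqLaw μ K) := by
  exact integrable_finsetSum (Finset.range n) fun ν _ => integrable_coupling hint K ν

theorem integrable_absCoupling (hint : Integrable (fun x : ℝ => x) μ) (K : ℕ) [NeZero K]
    (ζ : ℝ) : Integrable (absCoupling (K := K)) (disorderLaw μ K ζ) := by
  rw [disorderLaw_eq, integrable_prod_iff measurable_absCoupling.aestronglyMeasurable]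
  refine ⟨.of_forall fun n => integrable_absCoupling_section hint K n, ?_⟩
  simp only [Real.norm_eq_abs, abs_of_nonneg (absCoupling_nonneg _),
    integral_absCoupling_section hint]
  exact (integrable_natCast_poissonMeasure _).mul_const _

theorem integral_absCoupling (hint : Integrable (fun x : ℝ => x) μ) (K : ℕ) [NeZero K]
    {ζ : ℝ} (hζ : 0 ≤ ζ) : ∫ ω, absCoupling (K := K) ω ∂(disorderLaw μ K ζ) = ζ * ∫ x, |x| ∂μ := by
  have h := integrable_absCoupling hint K ζ
  rw [disorderLaw_eq] at h ⊢
  rw [integral_prod _ h]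
  simp only [integral_absCoupling_section hint]
  rw [integral_mul_const, integral_natCast_poissonMeasure, Real.coe_toNNReal _ hζ]

theorem integrable_log_partitionFn (hint : Integrable (fun x : ℝ => x) μ) {β h : ℝ} (hβ : 0 ≤ β)
    (hh : 0 ≤ h) (K : ℕ) [NeZero K] (ζ : ℝ) :
    Integrable (fun ω => Real.log (partitionFn β h ω)) (disorderLaw μ K ζ) :=
  Integrable.mono'
    ((integrable_const (K * Real.log 2)).add
      (((integrable_absCoupling hint K ζ).add (integrable_const (h * K))).const_mul β))
    (measurable_partitionFn β h).log.aestronglyMeasurable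
    (.of_forall fun ω => abs_log_partitionFn_le hβ hh ω)

theorem integrable_log_interpZ (hint : Integrable (fun x : ℝ => x) μ) {β h : ℝ} (hβ : 0 ≤ β)
    (hh : 0 ≤ h) (N M : ℕ) [NeZero N] [NeZero M] (α t : ℝ) :
    Integrable (fun ω => Real.log (interpZ β h ω)) (interpLaw μ N M α t) := by
  have h1 : Integrable (fun ω : InterpDisorder N M => absCoupling ω.1) (interpLaw μ N M α t) :=
    (integrable_absCoupling hint (N + M) _).comp_fst _
  have h2 : Integrable (fun ω : InterpDisorder N M => absCoupling ω.2.1) (interpLaw μ N M α t) :=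
    ((integrable_absCoupling hint N _).comp_fst _).comp_snd _
  have h3 : Integrable (fun ω : InterpDisorder N M => absCoupling ω.2.2) (interpLaw μ N M α t) :=
    ((integrable_absCoupling hint M _).comp_snd _).comp_snd _
  exact Integrable.mono'
    ((integrable_const ((N + M : ℕ) * Real.log 2)).add
      ((((h1.add h2).add h3).add (integrable_const (h * (N + M : ℕ)))).const_mul β))
    (measurable_interpZ β h).log.aestronglyMeasurable
    (.of_forall fun ω => abs_log_interpZ_le hβ hh ω)

end

/-! ### Expansion of the gain from one link -/

/-- The logarithm of the Gibbs average of `exp (β x s)` for a spin `s` of mean `w`. -/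
def linkLog (β w x : ℝ) : ℝ := Real.log (Real.cosh (β * x) + w * Real.sinh (β * x))

/-- For |w| ≤ 1 this is a convex combination of exp y and exp(-y), hence lies between exp(-|y|) and
exp |y|. -/
theorem cosh_add_mul_sinh_eq (w y : ℝ) : Real.cosh y + w * Real.sinh y =
    (1 + w) / 2 * Real.exp y + (1 - w) / 2 * Real.exp (-y) := by
  rw [Real.cosh_eq, Real.sinh_eq]; ring

theorem exp_neg_abs_le_cosh_add {w : ℝ} (hw : |w| ≤ 1) (y : ℝ) :
    Real.exp (-|y|) ≤ Real.cosh y + w * Real.sinh y := by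
  rw [cosh_add_mul_sinh_eq]
  obtain ⟨h1, h2⟩ := abs_le.1 hw
  have e1 : Real.exp (-|y|) ≤ Real.exp y := Real.exp_le_exp.2 (neg_abs_le y)
  have e2 : Real.exp (-|y|) ≤ Real.exp (-y) := Real.exp_le_exp.2 (neg_le_neg (le_abs_self y))
  nlinarith

theorem cosh_add_le_exp_abs {w : ℝ} (hw : |w| ≤ 1) (y : ℝ) :
    Real.cosh y + w * Real.sinh y ≤ Real.exp |y| := by
  rw [cosh_add_mul_sinh_eq]
  obtain ⟨h1, h2⟩ := abs_le.1 hw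
  have e1 : Real.exp y ≤ Real.exp |y| := Real.exp_le_exp.2 (le_abs_self y)
  have e2 : Real.exp (-y) ≤ Real.exp |y| := Real.exp_le_exp.2 (neg_le_abs y)
  nlinarith

theorem cosh_add_mul_sinh_pos {w : ℝ} (hw : |w| ≤ 1) (y : ℝ) :
    0 < Real.cosh y + w * Real.sinh y :=
  (Real.exp_pos _).trans_le (exp_neg_abs_le_cosh_add hw y)

theorem abs_linkLog_le {β w : ℝ} (hβ : 0 ≤ β) (hw : |w| ≤ 1) (x : ℝ) :
    |linkLog β w x| ≤ β * |x| := by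
  have h := cosh_add_mul_sinh_pos hw (β * x)
  have e : β * |x| = |β * x| := by rw [abs_mul, abs_of_nonneg hβ]
  rw [e, abs_le, linkLog]
  exact ⟨(Real.le_log_iff_exp_le h).2 (exp_neg_abs_le_cosh_add hw _),
    (Real.log_le_iff_le_exp h).2 (cosh_add_le_exp_abs hw _)⟩

theorem measurable_linkLog (β w : ℝ) : Measurable (linkLog β w) := by
  have h1 : Continuous fun x : ℝ => Real.cosh (β * x) + w * Real.sinh (β * x) := by fun_prop
  exact h1.measurable.log

/-- The product of the two arguments is cosh² - w² sinh² = cosh² (1 - w² tanh²), so odd powers of w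
disappear. -/
theorem linkLog_add_linkLog_neg {β w : ℝ} (hw : |w| ≤ 1) (x : ℝ) :
    linkLog β w x + linkLog β w (-x) =
      2 * linkLog β 0 x + Real.log (1 - w ^ 2 * Real.tanh (β * x) ^ 2) := by
  have hc : Real.cosh (β * x) ≠ 0 := (Real.cosh_pos _).ne'
  have h1 := cosh_add_mul_sinh_pos hw (β * x)
  have h2 := cosh_add_mul_sinh_pos hw (β * -x)
  have e : (Real.cosh (β * x) + w * Real.sinh (β * x)) *
      (Real.cosh (β * -x) + w * Real.sinh (β * -x)) =
      Real.cosh (β * x) ^ 2 * (1 - w ^ 2 * Real.tanh (β * x) ^ 2) := by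
    rw [mul_neg, Real.cosh_neg, Real.sinh_neg, Real.tanh_eq_sinh_div_cosh]
    field_simp
    ring
  have h3 : 1 - w ^ 2 * Real.tanh (β * x) ^ 2 ≠ 0 := by
    intro h0
    rw [h0, mul_zero] at e
    exact (mul_pos h1 h2).ne' e
  unfold linkLog
  rw [← Real.log_mul h1.ne' h2.ne', e, Real.log_mul (pow_ne_zero 2 hc) h3, Real.log_pow]
  simp

section
variable {μ : Measure ℝ}

theorem integrable_linkLog (hint : Integrable (fun x : ℝ => x) μ) {β w : ℝ} (hβ : 0 ≤ β)
    (hw : |w| ≤ 1) : Integrable (linkLog β w) μ :=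
  Integrable.mono' (hint.abs.const_mul β) (measurable_linkLog β w).aestronglyMeasurable
    (.of_forall fun x => abs_linkLog_le hβ hw x)

/-- The series coefficients `𝔼 tanh^{2n}(β J) / (2 n)`, `n = k + 1`. -/
def tanhCoeff (μ : Measure ℝ) (β : ℝ) (k : ℕ) : ℝ := tanhMoment μ β (k + 1) / (2 * ((k : ℝ) + 1))

theorem tanhMoment_nonneg (β : ℝ) (n : ℕ) : 0 ≤ tanhMoment μ β n :=
  integral_nonneg fun x => by
    show 0 ≤ Real.tanh (β * x) ^ (2 * n)
    rw [pow_mul]; positivity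

theorem tanhCoeff_nonneg (β : ℝ) (k : ℕ) : 0 ≤ tanhCoeff μ β k :=
  div_nonneg (tanhMoment_nonneg β _) (by positivity)

/-- By the symmetry of the coupling only even powers survive in the expansion of the average of
`linkLog`. -/
theorem hasSum_integral_linkLog (hsymm : μ.map (fun x : ℝ => -x) = μ)
    (hint : Integrable (fun x : ℝ => x) μ) {β w : ℝ} (hβ : 0 ≤ β) (hw : |w| ≤ 1) :
    HasSum (fun k : ℕ => tanhCoeff μ β k * w ^ (2 * (k + 1)))
      (∫ x, linkLog β 0 x ∂μ - ∫ x, linkLog β w x ∂μ) := by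
  have i0 : Integrable (linkLog β 0) μ := integrable_linkLog hint hβ (by simp)
  have i1 : Integrable (linkLog β w) μ := integrable_linkLog hint hβ hw
  have hneg : MeasurePreserving (fun x : ℝ => -x) μ μ := ⟨measurable_neg, hsymm⟩
  have i2 : Integrable (fun x => linkLog β w (-x)) μ := hneg.integrable_comp_of_integrable i1
  have e2 : ∫ x, linkLog β w (-x) ∂μ = ∫ x, linkLog β w x ∂μ := by
    rw [← integral_map (φ := fun x : ℝ => -x) (f := linkLog β w) measurable_neg.aemeasurable
      (measurable_linkLog β w).aestronglyMeasurable, hsymm]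
  have hpt : ∀ x : ℝ, HasSum (fun k : ℕ => Real.tanh (β * x) ^ (2 * (k + 1)) *
      (w ^ (2 * (k + 1)) / (2 * ((k : ℝ) + 1))))
      (linkLog β 0 x - (linkLog β w x + linkLog β w (-x)) / 2) := by
    intro x
    -- Strictness comes from |tanh| < 1, so the logarithmic series converges even at |w| = 1.
    have hlt : |w ^ 2 * Real.tanh (β * x) ^ 2| < 1 := by
      rw [abs_mul, abs_pow, abs_pow]
      have a1 : |w| ^ 2 ≤ 1 := pow_le_one₀ (abs_nonneg _) hw
      have a2 : |Real.tanh (β * x)| ^ 2 < 1 :=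
        pow_lt_one₀ (abs_nonneg _) (Real.abs_tanh_lt_one _) two_ne_zero
      nlinarith [sq_nonneg |w|, sq_nonneg |Real.tanh (β * x)|]
    have h := (Real.hasSum_pow_div_log_of_abs_lt_one hlt).mul_left (1 / 2)
    rw [linkLog_add_linkLog_neg hw]
    convert! h using 1
    · funext k
      rw [mul_pow, ← pow_mul, ← pow_mul]
      have : (k : ℝ) + 1 ≠ 0 := by positivity
      field_simp
    · ring
  have hnn : ∀ (k : ℕ) (x : ℝ), 0 ≤ Real.tanh (β * x) ^ (2 * (k + 1)) *
      (w ^ (2 * (k + 1)) / (2 * ((k : ℝ) + 1))) := fun k x => by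
    rw [pow_mul, pow_mul]; positivity
  -- All terms are nonnegative, so each dominates itself; the sum of the majorants is the limit
  -- function, integrable because `linkLog` is at most β|x|.
  have key := hasSum_integral_of_dominated_convergence (μ := μ)
    (F := fun (k : ℕ) (x : ℝ) => Real.tanh (β * x) ^ (2 * (k + 1)) *
      (w ^ (2 * (k + 1)) / (2 * ((k : ℝ) + 1))))
    (f := fun x => linkLog β 0 x - (linkLog β w x + linkLog β w (-x)) / 2)
    (fun (k : ℕ) (x : ℝ) => Real.tanh (β * x) ^ (2 * (k + 1)) *
      (w ^ (2 * (k + 1)) / (2 * ((k : ℝ) + 1)))) ?_ ?_ ?_ ?_ ?_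
  · convert! key using 1
    · funext k
      rw [integral_mul_const, tanhCoeff, tanhMoment]
      ring
    · have e3 : ∫ x, (linkLog β w x + linkLog β w (-x)) / 2 ∂μ = ∫ x, linkLog β w x ∂μ := by
        rw [integral_div, integral_add i1 i2, e2]
        ring
      rw [← e3]
      exact (integral_sub i0 ((i1.add i2).div_const 2)).symm
  · intro k
    have : Continuous fun x : ℝ => Real.tanh (β * x) := by
      simp only [Real.tanh_eq_sinh_div_cosh]
      exact (by fun_prop : Continuous fun x : ℝ => Real.sinh (β * x)).div (by fun_prop)
        fun x => (Real.cosh_pos _).ne'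
    exact ((this.pow _).mul_const _).measurable.aestronglyMeasurable
  · exact fun k => .of_forall fun x => by rw [Real.norm_eq_abs, abs_of_nonneg (hnn k x)]
  · exact .of_forall fun x => (hpt x).summable
  · simp only [fun x => (hpt x).tsum_eq]
    exact i0.sub ((i1.add i2).div_const 2)
  · exact .of_forall hpt

/-- This is the expansion at w = 1. It dominates the later series, since squared multi-overlaps have
replica averages of absolute value at most 1. -/
theorem summable_tanhCoeff (hsymm : μ.map (fun x : ℝ => -x) = μ)
    (hint : Integrable (fun x : ℝ => x) μ) {β : ℝ} (hβ : 0 ≤ β) :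
    Summable (tanhCoeff μ β) := by
  have := (hasSum_integral_linkLog hsymm hint hβ (w := 1) (by simp)).summable
  simpa using this

end

/-! ### Gibbs averages, replicas and multi-overlaps -/

/-- The Gibbs weight of a configuration. -/
def gibbsWeight {N M : ℕ} (β h : ℝ) (ω : InterpDisorder N M) (ρ : Config (N + M)) : ℝ :=
  Real.exp (-β * interpHamiltonian h ω ρ) / interpZ β h ω

theorem gibbsWeight_nonneg {N M : ℕ} (β h : ℝ) (ω : InterpDisorder N M) (ρ : Config (N + M)) :
    0 ≤ gibbsWeight β h ω ρ :=
  div_nonneg (Real.exp_pos _).le (interpZ_pos β h ω).le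

theorem sum_gibbsWeight {N M : ℕ} (β h : ℝ) (ω : InterpDisorder N M) :
    ∑ ρ, gibbsWeight β h ω ρ = 1 := by
  unfold gibbsWeight
  rw [← Finset.sum_div]
  exact div_self (interpZ_pos β h ω).ne'

theorem gibbsWeight_le_one {N M : ℕ} (β h : ℝ) (ω : InterpDisorder N M) (ρ : Config (N + M)) :
    gibbsWeight β h ω ρ ≤ 1 := by
  rw [← sum_gibbsWeight β h ω]
  exact Finset.single_le_sum (fun ρ _ => gibbsWeight_nonneg β h ω ρ) (Finset.mem_univ ρ)

theorem measurable_gibbsWeight {N M : ℕ} (β h : ℝ) (ρ : Config (N + M)) :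
    Measurable fun ω : InterpDisorder N M => gibbsWeight β h ω ρ :=
  ((measurable_interpHamiltonian h ρ).const_mul _).exp.div (measurable_interpZ β h)

theorem replicaGibbs_eq {N M m : ℕ} (β h : ℝ) (ω : InterpDisorder N M)
    (O : (Fin m → Config (N + M)) → ℝ) :
    replicaGibbs β h ω O = ∑ ρ, O ρ * ∏ a, gibbsWeight β h ω (ρ a) := rfl

theorem abs_replicaGibbs_le {N M m : ℕ} (β h : ℝ) (ω : InterpDisorder N M)
    (O : (Fin m → Config (N + M)) → ℝ) : |replicaGibbs β h ω O| ≤ ∑ ρ, |O ρ| := by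
  rw [replicaGibbs_eq]
  refine (Finset.abs_sum_le_sum_abs _ _).trans (Finset.sum_le_sum fun ρ _ => ?_)
  rw [abs_mul]
  refine mul_le_of_le_one_right (abs_nonneg _) ?_
  rw [abs_of_nonneg (Finset.prod_nonneg fun a _ => gibbsWeight_nonneg β h ω _)]
  exact Finset.prod_le_one (fun a _ => gibbsWeight_nonneg β h ω _)
    fun a _ => gibbsWeight_le_one β h ω _

theorem measurable_replicaGibbs {N M m : ℕ} (β h : ℝ) (O : (Fin m → Config (N + M)) → ℝ) :
    Measurable fun ω : InterpDisorder N M => replicaGibbs β h ω O := by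
  simp only [replicaGibbs_eq]
  exact Finset.measurable_sum _ fun ρ _ =>
    (Finset.measurable_prod _ fun a _ => measurable_gibbsWeight β h (ρ a)).const_mul _

theorem replicaGibbs_nonneg {N M m : ℕ} (β h : ℝ) (ω : InterpDisorder N M)
    {O : (Fin m → Config (N + M)) → ℝ} (hO : ∀ ρ, 0 ≤ O ρ) : 0 ≤ replicaGibbs β h ω O :=
  Finset.sum_nonneg fun ρ _ => mul_nonneg (hO ρ)
    (Finset.prod_nonneg fun _ _ => gibbsWeight_nonneg β h ω _)

theorem replicaGibbs_add {N M m : ℕ} (β h : ℝ) (ω : InterpDisorder N M)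
    (O O' : (Fin m → Config (N + M)) → ℝ) :
    replicaGibbs β h ω (fun ρ => O ρ + O' ρ) = replicaGibbs β h ω O + replicaGibbs β h ω O' := by
  simp only [replicaGibbs_eq, add_mul, Finset.sum_add_distrib]

theorem replicaGibbs_const_mul {N M m : ℕ} (β h : ℝ) (ω : InterpDisorder N M) (c : ℝ)
    (O : (Fin m → Config (N + M)) → ℝ) :
    replicaGibbs β h ω (fun ρ => c * O ρ) = c * replicaGibbs β h ω O := by
  simp only [replicaGibbs_eq, Finset.mul_sum, mul_assoc]

/-- The Gibbs average of the product of two spins. -/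
def twoPoint {N M : ℕ} (β h : ℝ) (ω : InterpDisorder N M) (i j : Fin (N + M)) : ℝ :=
  ∑ ρ, spin ρ i * spin ρ j * gibbsWeight β h ω ρ

theorem abs_twoPoint_le {N M : ℕ} (β h : ℝ) (ω : InterpDisorder N M) (i j : Fin (N + M)) :
    |twoPoint β h ω i j| ≤ 1 := by
  rw [← sum_gibbsWeight β h ω]
  refine (Finset.abs_sum_le_sum_abs _ _).trans (Finset.sum_le_sum fun ρ _ => ?_)
  rw [abs_mul, abs_mul, abs_spin, abs_spin, one_mul, one_mul,
    abs_of_nonneg (gibbsWeight_nonneg β h ω ρ)]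

/-- The multi-overlap of the spins at the sites `site i`. -/
def siteOverlap {K L m : ℕ} (site : Fin K → Fin L) (ρ : Fin m → Config L) : ℝ :=
  (1 / (K : ℝ)) * ∑ i, ∏ a, spin (ρ a) (site i)

/-- Replicas are independent for fixed disorder: in the double sum over sites, the average of the
product over replicas is the `m`-th power of a single two-point average. The map `site` treats the
whole system and its two blocks at once. -/
theorem replicaGibbs_siteOverlap_sq {K N M m : ℕ} (β h : ℝ) (ω : InterpDisorder N M)
    (site : Fin K → Fin (N + M)) :
    replicaGibbs β h ω (fun ρ : Fin m → Config (N + M) => siteOverlap site ρ ^ 2) =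
      (1 / (K : ℝ)) ^ 2 * ∑ i, ∑ j, twoPoint β h ω (site i) (site j) ^ m := by
  -- `Fintype.sum_pow` turns the `m`-th power of a sum over configurations into a sum over
  -- `m`-tuples of replicas.
  simp only [replicaGibbs_eq, siteOverlap, twoPoint, Fintype.sum_pow]
  simp only [sq (∑ _i, _), Finset.mul_sum, Finset.sum_mul]
  rw [Finset.sum_comm]
  refine Finset.sum_congr rfl fun i _ => ?_
  rw [Finset.sum_comm]
  refine Finset.sum_congr rfl fun j _ => Finset.sum_congr rfl fun ρ _ => ?_
  simp only [Finset.prod_mul_distrib]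
  ring

theorem exp_mul_of_sq_eq_one {s : ℝ} (hs : s ^ 2 = 1) (y : ℝ) :
    Real.exp (y * s) = Real.cosh y + s * Real.sinh y := by
  rcases sq_eq_one_iff.1 hs with rfl | rfl
  · rw [mul_one, one_mul, Real.cosh_add_sinh]
  · rw [mul_neg, mul_one, neg_one_mul, ← sub_eq_add_neg, Real.cosh_sub_sinh]

/-! ### Effect of one additional random link -/

/-- The partition function after the addition of the link `x` between the sites `site x.2.1` and
`site x.2.2`. -/
def linkedZ {K N M : ℕ} (β h : ℝ) (site : Fin K → Fin (N + M)) (ω : InterpDisorder N M)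
    (x : ℝ × Fin K × Fin K) : ℝ :=
  ∑ ρ, Real.exp (-β * (interpHamiltonian h ω ρ - x.1 * spin ρ (site x.2.1) * spin ρ (site x.2.2)))

/-- The ratio of the partition functions is the Gibbs average of exp(βJs), where s = ±1 is the
product of the two spins, and exp(βJs) = cosh βJ + s sinh βJ. -/
theorem log_linkedZ_sub {K N M : ℕ} (β h : ℝ) (site : Fin K → Fin (N + M))
    (ω : InterpDisorder N M) (x : ℝ × Fin K × Fin K) :
    Real.log (linkedZ β h site ω x) - Real.log (interpZ β h ω) =
      linkLog β (twoPoint β h ω (site x.2.1) (site x.2.2)) x.1 := by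
  have hpos : 0 < linkedZ β h site ω x :=
    Finset.sum_pos (fun _ _ => Real.exp_pos _) Finset.univ_nonempty
  rw [← Real.log_div hpos.ne' (interpZ_pos β h ω).ne', linkLog]
  congr 1
  have e : Real.cosh (β * x.1) = ∑ ρ, Real.cosh (β * x.1) * gibbsWeight β h ω ρ := by
    rw [← Finset.mul_sum, sum_gibbsWeight, mul_one]
  rw [e, twoPoint, Finset.sum_mul, ← Finset.sum_add_distrib, linkedZ, Finset.sum_div]
  refine Finset.sum_congr rfl fun ρ _ => ?_
  have hs : (spin ρ (site x.2.1) * spin ρ (site x.2.2)) ^ 2 = 1 := by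
    rw [mul_pow, spin_sq, spin_sq, one_mul]
  have e1 : -β * (interpHamiltonian h ω ρ - x.1 * spin ρ (site x.2.1) * spin ρ (site x.2.2)) =
      (β * x.1) * (spin ρ (site x.2.1) * spin ρ (site x.2.2)) +
        -β * interpHamiltonian h ω ρ := by ring
  rw [e1, Real.exp_add, exp_mul_of_sq_eq_one hs, gibbsWeight]
  ring

theorem measurable_linkedZ {K N M : ℕ} (β h : ℝ) (site : Fin K → Fin (N + M)) :
    Measurable fun p : InterpDisorder N M × (ℝ × Fin K × Fin K) => linkedZ β h site p.1 p.2 := by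
  unfold linkedZ
  refine Finset.measurable_sum _ fun ρ _ => ?_
  have h1 := measurable_interpHamiltonian h ρ
  have h2 : Measurable fun i : Fin K => spin ρ (site i) := Measurable.of_discrete
  fun_prop

section
variable {μ : Measure ℝ} [IsProbabilityMeasure μ]

/-- The mean logarithmic gain from the addition of one random link. -/
def linkGain (μ : Measure ℝ) {K N M : ℕ} [NeZero K] (β h : ℝ) (site : Fin K → Fin (N + M))
    (ω : InterpDisorder N M) : ℝ :=
  ∫ x, (Real.log (linkedZ β h site ω x) - Real.log (interpZ β h ω)) ∂(linkLaw μ K)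

theorem abs_log_linkedZ_sub_le {K N M : ℕ} {β h : ℝ} (hβ : 0 ≤ β) (site : Fin K → Fin (N + M))
    (ω : InterpDisorder N M) (x : ℝ × Fin K × Fin K) :
    |Real.log (linkedZ β h site ω x) - Real.log (interpZ β h ω)| ≤ β * |x.1| := by
  rw [log_linkedZ_sub]
  exact abs_linkLog_le hβ (abs_twoPoint_le _ _ _ _ _) _

theorem integrable_log_linkedZ_sub (hint : Integrable (fun x : ℝ => x) μ) {K N M : ℕ} [NeZero K]
    {β h : ℝ} (hβ : 0 ≤ β) (site : Fin K → Fin (N + M)) (P : Measure (InterpDisorder N M))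
    [IsProbabilityMeasure P] :
    Integrable (fun p : InterpDisorder N M × (ℝ × Fin K × Fin K) =>
      Real.log (linkedZ β h site p.1 p.2) - Real.log (interpZ β h p.1)) (P.prod (linkLaw μ K)) := by
  have h1 : Integrable (fun p : InterpDisorder N M × (ℝ × Fin K × Fin K) => β * |p.2.1|)
      (P.prod (linkLaw μ K)) := by
    have h2 : Integrable (fun x : ℝ × Fin K × Fin K => x.1) (linkLaw μ K) := hint.comp_fst _
    exact (h2.abs.const_mul β).comp_snd P
  exact h1.mono' ((measurable_linkedZ β h site).log.sub
    ((measurable_interpZ β h).comp measurable_fst).log).aestronglyMeasurable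
    (.of_forall fun p => abs_log_linkedZ_sub_le hβ site p.1 p.2)

theorem uniformSite_real_singleton (K : ℕ) [NeZero K] (i : Fin K) :
    (uniformSite K).real {i} = 1 / (K : ℝ) := by
  rw [uniformSite, measureReal_def, PMF.toMeasure_apply_singleton _ _ (measurableSet_singleton i)]
  simp

theorem integral_uniformSite_prod (K : ℕ) [NeZero K] (f : Fin K × Fin K → ℝ) :
    ∫ p, f p ∂((uniformSite K).prod (uniformSite K)) =
      (1 / (K : ℝ)) ^ 2 * ∑ i, ∑ j, f (i, j) := by
  rw [integral_fintype (Integrable.of_finite), Fintype.sum_prod_type, Finset.mul_sum]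
  refine Finset.sum_congr rfl fun i _ => ?_
  rw [Finset.mul_sum]
  refine Finset.sum_congr rfl fun j _ => ?_
  rw [← singleton_prod_singleton, measureReal_prod_prod, uniformSite_real_singleton,
    uniformSite_real_singleton, smul_eq_mul]
  ring

theorem linkGain_eq (hint : Integrable (fun x : ℝ => x) μ) {K N M : ℕ} [NeZero K] {β h : ℝ}
    (hβ : 0 ≤ β) (site : Fin K → Fin (N + M)) (ω : InterpDisorder N M) :
    linkGain μ β h site ω = (1 / (K : ℝ)) ^ 2 *
      ∑ i, ∑ j, ∫ x, linkLog β (twoPoint β h ω (site i) (site j)) x ∂μ := by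
  have hm : Measurable fun x : ℝ × Fin K × Fin K =>
      Real.log (linkedZ β h site ω x) - Real.log (interpZ β h ω) :=
    ((measurable_linkedZ β h site).comp (measurable_const.prodMk measurable_id)).log.sub_const _
  have h2 : Integrable (fun x : ℝ × Fin K × Fin K => x.1) (linkLaw μ K) := hint.comp_fst _
  have hi : Integrable (fun x : ℝ × Fin K × Fin K =>
      Real.log (linkedZ β h site ω x) - Real.log (interpZ β h ω)) (linkLaw μ K) :=
    (h2.abs.const_mul β).mono' hm.aestronglyMeasurable
      (.of_forall fun x => abs_log_linkedZ_sub_le hβ site ω x)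
  unfold linkGain
  rw [linkLaw] at hi ⊢
  rw [integral_prod_symm _ hi]
  simp only [log_linkedZ_sub]
  exact integral_uniformSite_prod K _

/-- Averaging the expansion in w over the two uniform sites produces the squared overlaps. The
constant `∫ linkLog β 0` does not depend on `K` or `site`, which is what makes it cancel later. -/
theorem hasSum_linkGain (hsymm : μ.map (fun x : ℝ => -x) = μ)
    (hint : Integrable (fun x : ℝ => x) μ) {K N M : ℕ} [NeZero K] {β h : ℝ}
    (hβ : 0 ≤ β) (site : Fin K → Fin (N + M)) (ω : InterpDisorder N M) :
    HasSum (fun k : ℕ => tanhCoeff μ β k * replicaGibbs β h ω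
      (fun ρ : Fin (2 * (k + 1)) → Config (N + M) => siteOverlap site ρ ^ 2))
      (∫ x, linkLog β 0 x ∂μ - linkGain μ β h site ω) := by
  have hK : (K : ℝ) ≠ 0 := Nat.cast_ne_zero.2 (NeZero.ne K)
  have h1 : HasSum (fun k : ℕ => (1 / (K : ℝ)) ^ 2 * ∑ i : Fin K, ∑ j : Fin K,
      tanhCoeff μ β k * twoPoint β h ω (site i) (site j) ^ (2 * (k + 1)))
      ((1 / (K : ℝ)) ^ 2 * ∑ i : Fin K, ∑ j : Fin K, (∫ x, linkLog β 0 x ∂μ -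
        ∫ x, linkLog β (twoPoint β h ω (site i) (site j)) x ∂μ)) :=
    (hasSum_sum fun i _ => hasSum_sum fun j _ =>
      hasSum_integral_linkLog hsymm hint hβ (abs_twoPoint_le β h ω _ _)).mul_left _
  convert! h1 using 1
  · funext k
    rw [replicaGibbs_siteOverlap_sq]
    simp only [Finset.mul_sum]
    refine Finset.sum_congr rfl fun i _ => Finset.sum_congr rfl fun j _ => ?_
    ring
  · rw [linkGain_eq hint hβ]
    simp only [Finset.sum_sub_distrib, Finset.sum_const, Finset.card_univ, Fintype.card_fin,
      nsmul_eq_mul, mul_sub]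
    field_simp

theorem abs_replicaGibbs_siteOverlap_sq_le {K N M m : ℕ} [NeZero K] (β h : ℝ)
    (site : Fin K → Fin (N + M)) (ω : InterpDisorder N M) :
    |replicaGibbs β h ω (fun ρ : Fin m → Config (N + M) => siteOverlap site ρ ^ 2)| ≤ 1 := by
  have hK : (K : ℝ) ≠ 0 := Nat.cast_ne_zero.2 (NeZero.ne K)
  rw [replicaGibbs_siteOverlap_sq, abs_mul, abs_of_nonneg (by positivity)]
  calc (1 / (K : ℝ)) ^ 2 * |∑ i, ∑ j, twoPoint β h ω (site i) (site j) ^ m|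
      ≤ (1 / (K : ℝ)) ^ 2 * ∑ _i : Fin K, ∑ _j : Fin K, 1 := by
        gcongr
        refine (Finset.abs_sum_le_sum_abs _ _).trans (Finset.sum_le_sum fun i _ =>
          (Finset.abs_sum_le_sum_abs _ _).trans (Finset.sum_le_sum fun j _ => ?_))
        rw [abs_pow]
        exact pow_le_one₀ (abs_nonneg _) (abs_twoPoint_le _ _ _ _ _)
    _ = 1 := by
        simp only [Finset.sum_const, Finset.card_univ, Fintype.card_fin, nsmul_eq_mul]
        field_simp

theorem integrable_linkGain (hint : Integrable (fun x : ℝ => x) μ) {K N M : ℕ} [NeZero K]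
    {β h : ℝ} (hβ : 0 ≤ β) (site : Fin K → Fin (N + M)) (P : Measure (InterpDisorder N M))
    [IsProbabilityMeasure P] : Integrable (linkGain μ β h site) P :=
  (integrable_log_linkedZ_sub hint hβ site P).integral_prod_left

theorem integrable_replicaGibbs {N M m : ℕ} (β h : ℝ) (O : (Fin m → Config (N + M)) → ℝ)
    (P : Measure (InterpDisorder N M)) [IsProbabilityMeasure P] :
    Integrable (fun ω => replicaGibbs β h ω O) P :=
  (integrable_const (∑ ρ, |O ρ|)).mono' (measurable_replicaGibbs β h O).aestronglyMeasurable
    (.of_forall fun ω => abs_replicaGibbs_le β h ω O)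

theorem hasSum_integral_linkGain (hsymm : μ.map (fun x : ℝ => -x) = μ)
    (hint : Integrable (fun x : ℝ => x) μ) {K N M : ℕ} [NeZero K] [NeZero N] [NeZero M]
    {β h : ℝ} (hβ : 0 ≤ β) (site : Fin K → Fin (N + M)) (α t : ℝ) :
    HasSum (fun k : ℕ => tanhCoeff μ β k * bracket μ α β h t
      (fun ρ : Fin (2 * (k + 1)) → Config (N + M) => siteOverlap site ρ ^ 2))
      (∫ x, linkLog β 0 x ∂μ - ∫ ω, linkGain μ β h site ω ∂(interpLaw μ N M α t)) := by
  have key := hasSum_integral_of_dominated_convergence (μ := interpLaw μ N M α t)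
    (F := fun (k : ℕ) ω => tanhCoeff μ β k * replicaGibbs β h ω
      (fun ρ : Fin (2 * (k + 1)) → Config (N + M) => siteOverlap site ρ ^ 2))
    (f := fun ω => ∫ x, linkLog β 0 x ∂μ - linkGain μ β h site ω)
    (fun k _ => tanhCoeff μ β k)
    (fun k => ((measurable_replicaGibbs β h _).const_mul _).aestronglyMeasurable)
    (fun k => .of_forall fun ω => by
      rw [Real.norm_eq_abs, abs_mul, abs_of_nonneg (tanhCoeff_nonneg β k)]
      exact mul_le_of_le_one_right (tanhCoeff_nonneg β k)
        (abs_replicaGibbs_siteOverlap_sq_le β h site ω))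
    (.of_forall fun _ => summable_tanhCoeff hsymm hint hβ) (integrable_const _)
    (.of_forall fun ω => hasSum_linkGain hsymm hint hβ site ω)
  convert! key using 1
  · funext k
    rw [integral_const_mul, bracket]
  · rw [integral_sub (integrable_const _) (integrable_linkGain hint hβ site _)]
    simp

end

/-! ### Increments of the mean of ln Z in the number of links -/

/-- The mean of `ln Z` for fixed numbers of interaction terms. -/
def fixedCountPhi (μ : Measure ℝ) [IsProbabilityMeasure μ] (N M : ℕ) [NeZero N] [NeZero M]
    (β h : ℝ) (i : ℕ × ℕ × ℕ) : ℝ :=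
  ∫ s, Real.log (interpZ β h (zipDisorder (N := N) (M := M) (i, s))) ∂(seq3Law μ N M)

theorem measurable_zipDisorder_mk {N M : ℕ} (i : ℕ × ℕ × ℕ) :
    Measurable fun s : Seq3 N M => zipDisorder (i, s) := by
  unfold zipDisorder
  fun_prop

theorem measurePreserving_act_snd {A B X : Type*} [MeasurableSpace A] [MeasurableSpace B]
    [MeasurableSpace X] {a : Measure A} {b : Measure B} {ξ : Measure X} [SFinite a] [SFinite b]
    [SFinite ξ] {g : B × X → B} (hg : MeasurePreserving g (b.prod ξ) b) :
    MeasurePreserving (fun p : (A × B) × X => (p.1.1, g (p.1.2, p.2))) ((a.prod b).prod ξ)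
      (a.prod b) :=
  ((MeasurePreserving.id a).prod hg).comp (measurePreserving_prodAssoc a b ξ)

theorem measurePreserving_act_fst {A B X : Type*} [MeasurableSpace A] [MeasurableSpace B]
    [MeasurableSpace X] {a : Measure A} {b : Measure B} {ξ : Measure X} [SFinite a] [SFinite b]
    [SFinite ξ] {f : A × X → A} (hf : MeasurePreserving f (a.prod ξ) a) :
    MeasurePreserving (fun p : (A × B) × X => (f (p.1.1, p.2), p.1.2)) ((a.prod b).prod ξ)
      (a.prod b) := by
  have h1 : MeasurePreserving (Prod.map Prod.swap id) ((a.prod b).prod ξ) ((b.prod a).prod ξ) :=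
    Measure.measurePreserving_swap.prod (MeasurePreserving.id ξ)
  exact (Measure.measurePreserving_swap.comp (measurePreserving_act_snd hf)).comp h1

section
variable {μ : Measure ℝ} [IsProbabilityMeasure μ] {N M : ℕ} [NeZero N] [NeZero M]

/-- The majorant of `|ln Z|` for fixed numbers of interaction terms. -/
def logMajorant (β h : ℝ) (ω : InterpDisorder N M) : ℝ :=
  (N + M : ℕ) * Real.log 2 +
    β * (absCoupling ω.1 + absCoupling ω.2.1 + absCoupling ω.2.2 + h * (N + M : ℕ))

theorem integrable_logMajorant (hint : Integrable (fun x : ℝ => x) μ) (β h : ℝ)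
    (i : ℕ × ℕ × ℕ) :
    Integrable (fun s : Seq3 N M => logMajorant β h (zipDisorder (i, s))) (seq3Law μ N M) ∧
    ∫ s : Seq3 N M, logMajorant β h (zipDisorder (i, s)) ∂(seq3Law μ N M) =
      (N + M : ℕ) * Real.log 2 +
        β * ((i.1 + i.2.1 + i.2.2) * ∫ x, |x| ∂μ + h * (N + M : ℕ)) := by
  have h1 : Integrable (fun s : Seq3 N M => absCoupling (i.1, s.1)) (seq3Law μ N M) :=
    (integrable_absCoupling_section hint (N + M) i.1).comp_fst _
  have h2 : Integrable (fun s : Seq3 N M => absCoupling (i.2.1, s.2.1)) (seq3Law μ N M) :=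
    ((integrable_absCoupling_section hint N i.2.1).comp_fst _).comp_snd _
  have h3 : Integrable (fun s : Seq3 N M => absCoupling (i.2.2, s.2.2)) (seq3Law μ N M) :=
    ((integrable_absCoupling_section hint M i.2.2).comp_snd _).comp_snd _
  have e1 : ∫ s : Seq3 N M, absCoupling (i.1, s.1) ∂(seq3Law μ N M) = i.1 * ∫ x, |x| ∂μ := by
    rw [seq3Law, integral_fun_fst (fun s => absCoupling (i.1, s)),
      integral_absCoupling_section hint]
    simp
  have e2 : ∫ s : Seq3 N M, absCoupling (i.2.1, s.2.1) ∂(seq3Law μ N M)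
      = i.2.1 * ∫ x, |x| ∂μ := by
    rw [seq3Law, integral_fun_snd (fun s : (ℕ → ℝ × Fin N × Fin N) × (ℕ → ℝ × Fin M × Fin M) =>
      absCoupling (i.2.1, s.1)), integral_fun_fst (fun s => absCoupling (i.2.1, s)),
      integral_absCoupling_section hint]
    simp
  have e3 : ∫ s : Seq3 N M, absCoupling (i.2.2, s.2.2) ∂(seq3Law μ N M)
      = i.2.2 * ∫ x, |x| ∂μ := by
    rw [seq3Law, integral_fun_snd (fun s : (ℕ → ℝ × Fin N × Fin N) × (ℕ → ℝ × Fin M × Fin M) =>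
      absCoupling (i.2.2, s.2)), integral_fun_snd (fun s => absCoupling (i.2.2, s)),
      integral_absCoupling_section hint]
    simp
  have h12 : Integrable (fun s : Seq3 N M => absCoupling (i.1, s.1) + absCoupling (i.2.1, s.2.1))
      (seq3Law μ N M) := h1.add h2
  have h123 : Integrable (fun s : Seq3 N M => absCoupling (i.1, s.1) + absCoupling (i.2.1, s.2.1) +
      absCoupling (i.2.2, s.2.2)) (seq3Law μ N M) := h12.add h3
  have h1234 : Integrable (fun s : Seq3 N M => absCoupling (i.1, s.1) +
      absCoupling (i.2.1, s.2.1) + absCoupling (i.2.2, s.2.2) + h * (N + M : ℕ))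
      (seq3Law μ N M) := h123.add (integrable_const _)
  refine ⟨(integrable_const ((N + M : ℕ) * Real.log 2)).add (h1234.const_mul β), ?_⟩
  simp only [logMajorant, zipDisorder]
  rw [integral_add (integrable_const _) (h1234.const_mul β), integral_const_mul β,
    integral_add h123 (integrable_const _), integral_add h12 h3, integral_add h1 h2, e1, e2, e3]
  simp only [integral_const, probReal_univ, smul_eq_mul, one_mul]
  ring

theorem integrable_log_interpZ_zip (hint : Integrable (fun x : ℝ => x) μ) {β h : ℝ} (hβ : 0 ≤ β)
    (hh : 0 ≤ h) (i : ℕ × ℕ × ℕ) :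
    Integrable (fun s : Seq3 N M => Real.log (interpZ β h (zipDisorder (i, s))))
      (seq3Law μ N M) :=
  (integrable_logMajorant hint β h i).1.mono'
    ((measurable_interpZ β h).comp (measurable_zipDisorder_mk i)).log.aestronglyMeasurable
    (.of_forall fun s => by
      rw [Real.norm_eq_abs]
      exact abs_log_interpZ_le hβ hh _)

theorem exists_abs_fixedCountPhi_le (hint : Integrable (fun x : ℝ => x) μ) {β h : ℝ}
    (hβ : 0 ≤ β) (hh : 0 ≤ h) :
    ∃ C, ∀ i, |fixedCountPhi μ N M β h i| ≤ C * expGrowth i := by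
  -- The bound on ln Z is linear in the counts; each count is at most `expGrowth i`, whence the 3,
  -- and the constant terms use 1 ≤ `expGrowth i`.
  refine ⟨(N + M : ℕ) * Real.log 2 + β * (3 * ∫ x, |x| ∂μ + h * (N + M : ℕ)), fun i => ?_⟩
  have hJ : 0 ≤ ∫ x, |x| ∂μ := integral_nonneg fun x => abs_nonneg x
  have hl : 0 ≤ Real.log 2 := Real.log_nonneg one_le_two
  have h1 : |fixedCountPhi μ N M β h i| ≤ (N + M : ℕ) * Real.log 2 +
        β * ((i.1 + i.2.1 + i.2.2) * ∫ x, |x| ∂μ + h * (N + M : ℕ)) := by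
    have hm := integrable_logMajorant (μ := μ) (N := N) (M := M) hint β h i
    rw [← hm.2]
    exact norm_integral_le_of_norm_le hm.1
      (.of_forall fun s => by
        rw [Real.norm_eq_abs]
        exact abs_log_interpZ_le hβ hh _)
  have g : ∀ n : ℕ, (n : ℝ) ≤ 2 ^ n := fun n => by exact_mod_cast Nat.lt_two_pow_self.le
  have g1 : ∀ n : ℕ, (1 : ℝ) ≤ 2 ^ n := fun n => one_le_pow₀ one_le_two
  have hG : 1 ≤ expGrowth i := by
    unfold expGrowth
    exact one_le_mul_of_one_le_of_one_le
      (one_le_mul_of_one_le_of_one_le (g1 _) (g1 _)) (g1 _)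
  have k1 : (i.1 : ℝ) ≤ expGrowth i := by
    unfold expGrowth
    nlinarith [g i.1, g1 i.1, one_le_mul_of_one_le_of_one_le (g1 i.2.1) (g1 i.2.2)]
  have k2 : (i.2.1 : ℝ) ≤ expGrowth i := by
    unfold expGrowth
    nlinarith [g i.2.1, g1 i.2.1, one_le_mul_of_one_le_of_one_le (g1 i.1) (g1 i.2.2)]
  have k3 : (i.2.2 : ℝ) ≤ expGrowth i := by
    unfold expGrowth
    nlinarith [g i.2.2, g1 i.2.2, one_le_mul_of_one_le_of_one_le (g1 i.1) (g1 i.2.1)]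
  refine h1.trans ?_
  have a1 : ((N + M : ℕ) : ℝ) * Real.log 2 ≤ (N + M : ℕ) * Real.log 2 * expGrowth i :=
    le_mul_of_one_le_right (by positivity) hG
  have a2 : h * (N + M : ℕ) ≤ h * (N + M : ℕ) * expGrowth i :=
    le_mul_of_one_le_right (by positivity) hG
  have a3 : ((i.1 : ℝ) + i.2.1 + i.2.2) * ∫ x, |x| ∂μ ≤ (3 * ∫ x, |x| ∂μ) * expGrowth i := by
    calc _ ≤ (3 * expGrowth i) * ∫ x, |x| ∂μ := by
          gcongr
          linarith
      _ = _ := by ring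
  have a4 := mul_le_mul_of_nonneg_left (add_le_add a3 a2) hβ
  linarith [add_le_add a1 a4]

/-- Adding one term to one of the Hamiltonians adds the mean gain of one link. -/
theorem fixedCountPhi_sub (hint : Integrable (fun x : ℝ => x) μ) {K : ℕ} [NeZero K] {β h : ℝ}
    (hβ : 0 ≤ β) (hh : 0 ≤ h) (site : Fin K → Fin (N + M)) {i i' : ℕ × ℕ × ℕ}
    {upd : Seq3 N M × (ℝ × Fin K × Fin K) → Seq3 N M}
    (hupd : MeasurePreserving upd ((seq3Law μ N M).prod (linkLaw μ K)) (seq3Law μ N M))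
    (hH : ∀ s x ρ, interpHamiltonian h (zipDisorder (i', upd (s, x))) ρ =
      interpHamiltonian h (zipDisorder (i, s)) ρ -
        x.1 * spin ρ (site x.2.1) * spin ρ (site x.2.2)) :
    fixedCountPhi μ N M β h i' - fixedCountPhi μ N M β h i =
      ∫ s, linkGain μ β h site (zipDisorder (i, s)) ∂(seq3Law μ N M) := by
  have hZ : ∀ s x, interpZ β h (zipDisorder (i', upd (s, x))) =
      linkedZ β h site (zipDisorder (i, s)) x := fun s x => by
    simp only [interpZ, linkedZ, hH]
  have i1 := integrable_log_interpZ_zip (μ := μ) (N := N) (M := M) hint hβ hh i'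
  have i0 := integrable_log_interpZ_zip (μ := μ) (N := N) (M := M) hint hβ hh i
  have iA : Integrable (fun p => Real.log (interpZ β h (zipDisorder (i', upd p))))
      ((seq3Law μ N M).prod (linkLaw μ K)) := hupd.integrable_comp_of_integrable i1
  have iB := i0.comp_fst (linkLaw μ K)
  -- Both means are written on the space enlarged by a fresh link, so their difference can be
  -- integrated over that link first.
  have e1 : fixedCountPhi μ N M β h i' = ∫ p, Real.log (interpZ β h (zipDisorder (i', upd p)))
      ∂((seq3Law μ N M).prod (linkLaw μ K)) := by
    have := integral_map (f := fun s => Real.log (interpZ β h (zipDisorder (i', s))))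
      hupd.measurable.aemeasurable (by rw [hupd.map_eq]; exact i1.aestronglyMeasurable)
    rw [hupd.map_eq] at this
    exact this
  have e0 : fixedCountPhi μ N M β h i = ∫ p : Seq3 N M × (ℝ × Fin K × Fin K),
      Real.log (interpZ β h (zipDisorder (i, p.1))) ∂((seq3Law μ N M).prod (linkLaw μ K)) := by
    rw [integral_fun_fst (fun s => Real.log (interpZ β h (zipDisorder (i, s))))]
    simp [fixedCountPhi]
  have iAB : Integrable (fun p : Seq3 N M × (ℝ × Fin K × Fin K) =>
      Real.log (interpZ β h (zipDisorder (i', upd p))) -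
        Real.log (interpZ β h (zipDisorder (i, p.1)))) ((seq3Law μ N M).prod (linkLaw μ K)) :=
    iA.sub iB
  rw [e1, e0, ← integral_sub iA iB, integral_prod _ iAB]
  simp only [hZ, linkGain]

/-- With count n the Hamiltonian reads only indices below n, so overwriting index n and raising the
count adds exactly one term. -/
theorem hamiltonian_update {K : ℕ} (n : ℕ) (s : ℕ → ℝ × Fin K × Fin K) (x : ℝ × Fin K × Fin K)
    (σ : Config K) : hamiltonian (n + 1, Function.update s n x) σ =
      hamiltonian (n, s) σ - x.1 * spin σ x.2.1 * spin σ x.2.2 := by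
  unfold hamiltonian
  simp only [Finset.sum_range_succ, Function.update_self]
  rw [neg_add, sub_eq_add_neg]
  congr 2
  refine Finset.sum_congr rfl fun ν hν => ?_
  rw [Function.update_of_ne (Finset.mem_range.1 hν).ne]

theorem fixedCountPhi_incFst_sub (hint : Integrable (fun x : ℝ => x) μ) {β h : ℝ}
    (hβ : 0 ≤ β) (hh : 0 ≤ h) (i : ℕ × ℕ × ℕ) :
    fixedCountPhi μ N M β h (incFst i) - fixedCountPhi μ N M β h i =
      ∫ s, linkGain μ β h (id : Fin (N + M) → Fin (N + M)) (zipDisorder (i, s))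
        ∂(seq3Law μ N M) := by
  refine fixedCountPhi_sub hint hβ hh _
    (measurePreserving_act_fst (measurePreserving_update (linkLaw μ (N + M)) i.1)) ?_
  intro s x ρ
  simp only [interpHamiltonian, zipDisorder, incFst, hamiltonian_update, id_eq]
  ring

theorem fixedCountPhi_incSnd_sub (hint : Integrable (fun x : ℝ => x) μ) {β h : ℝ}
    (hβ : 0 ≤ β) (hh : 0 ≤ h) (i : ℕ × ℕ × ℕ) :
    fixedCountPhi μ N M β h (incSnd i) - fixedCountPhi μ N M β h i =
      ∫ s, linkGain μ β h (Fin.castAdd M : Fin N → Fin (N + M)) (zipDisorder (i, s))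
        ∂(seq3Law μ N M) := by
  refine fixedCountPhi_sub hint hβ hh _
    (measurePreserving_act_snd (measurePreserving_act_fst
      (measurePreserving_update (linkLaw μ N) i.2.1))) ?_
  intro s x ρ
  simp only [interpHamiltonian, zipDisorder, incSnd, hamiltonian_update]
  simp only [spin, cavity]
  ring

theorem fixedCountPhi_incThd_sub (hint : Integrable (fun x : ℝ => x) μ) {β h : ℝ}
    (hβ : 0 ≤ β) (hh : 0 ≤ h) (i : ℕ × ℕ × ℕ) :
    fixedCountPhi μ N M β h (incThd i) - fixedCountPhi μ N M β h i =
      ∫ s, linkGain μ β h (Fin.natAdd N : Fin M → Fin (N + M)) (zipDisorder (i, s))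
        ∂(seq3Law μ N M) := by
  refine fixedCountPhi_sub hint hβ hh _
    (measurePreserving_act_snd (measurePreserving_act_snd
      (measurePreserving_update (linkLaw μ M) i.2.2))) ?_
  intro s x ρ
  simp only [interpHamiltonian, zipDisorder, incThd, hamiltonian_update]
  simp only [spin, added]
  ring

end

/-! ### The `B` terms and the derivative of the interpolation -/

section
variable {μ : Measure ℝ} [IsProbabilityMeasure μ] {N M : ℕ} [NeZero N] [NeZero M]

theorem bracket_add {m : ℕ} (α β h t : ℝ) (O O' : (Fin m → Config (N + M)) → ℝ) :
    bracket μ α β h t (fun ρ => O ρ + O' ρ) = bracket μ α β h t O + bracket μ α β h t O' := by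
  unfold bracket
  simp only [replicaGibbs_add]
  exact integral_add (integrable_replicaGibbs β h O _) (integrable_replicaGibbs β h O' _)

theorem bracket_const_mul {m : ℕ} (α β h t c : ℝ) (O : (Fin m → Config (N + M)) → ℝ) :
    bracket μ α β h t (fun ρ => c * O ρ) = c * bracket μ α β h t O := by
  unfold bracket
  simp only [replicaGibbs_const_mul]
  exact integral_const_mul c _

theorem bracket_nonneg {m : ℕ} (α β h t : ℝ) {O : (Fin m → Config (N + M)) → ℝ}
    (hO : ∀ ρ, 0 ≤ O ρ) : 0 ≤ bracket μ α β h t O :=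
  integral_nonneg fun ω => replicaGibbs_nonneg β h ω hO

theorem overlapDist_nonneg (α β h : ℝ) (n : ℕ) (t : ℝ) :
    0 ≤ overlapDist μ N M α β h n t :=
  bracket_nonneg α β h t fun _ => sq_nonneg _

/-- Pointwise, Nq² + Mq̃² = (Nq + Mq̃)²/(N+M) + NM/(N+M) (q - q̃)². -/
theorem B_eq_neg_overlapDist (α β h : ℝ) (n : ℕ) (t : ℝ) :
    B μ N M α β h n t = -((N : ℝ) * M / (N + M) * overlapDist μ N M α β h n t) := by
  have hN : (0 : ℝ) < N := Nat.cast_pos.2 (NeZero.pos N)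
  have hM : (0 : ℝ) < M := Nat.cast_pos.2 (NeZero.pos M)
  have hNM : (N : ℝ) + M ≠ 0 := by positivity
  have e : bracket μ α β h t (fun ρ : Fin (2 * n) → Config (N + M) =>
      q ρ ^ 2 * N + qTilde ρ ^ 2 * M) = bracket μ α β h t (fun ρ : Fin (2 * n) → Config (N + M) =>
        1 / ((N : ℝ) + M) *
          ((q ρ * N) ^ 2 + 2 * (q ρ * N) * (qTilde ρ * M) + (qTilde ρ * M) ^ 2) +
        (N : ℝ) * M / (N + M) * (q ρ - qTilde ρ) ^ 2) := by
    congr 1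
    funext ρ
    field_simp
    ring
  have e' := e.trans (bracket_add _ _ _ _ _ _)
  rw [bracket_const_mul, bracket_const_mul] at e'
  rw [B, e', overlapDist]
  ring

/-- The overlap Q of the whole system satisfies (N+M)Q = Nq + Mq̃. This puts `B` in the form of the
three link gains, with weights N+M, -N and -M. -/
theorem B_eq_siteOverlap (α β h : ℝ) (n : ℕ) (t : ℝ) :
    B μ N M α β h n t =
      ((N + M : ℕ) : ℝ) * bracket μ α β h t (fun ρ : Fin (2 * n) → Config (N + M) =>
        siteOverlap (id : Fin (N + M) → Fin (N + M)) ρ ^ 2)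
      - N * bracket μ α β h t (fun ρ : Fin (2 * n) → Config (N + M) =>
        siteOverlap (Fin.castAdd M : Fin N → Fin (N + M)) ρ ^ 2)
      - M * bracket μ α β h t (fun ρ : Fin (2 * n) → Config (N + M) =>
        siteOverlap (Fin.natAdd N : Fin M → Fin (N + M)) ρ ^ 2) := by
  have hN : (0 : ℝ) < N := Nat.cast_pos.2 (NeZero.pos N)
  have hM : (0 : ℝ) < M := Nat.cast_pos.2 (NeZero.pos M)
  have hNM : (N : ℝ) + M ≠ 0 := by positivity
  have e1 : bracket μ α β h t (fun ρ : Fin (2 * n) → Config (N + M) =>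
      q ρ ^ 2 * N + qTilde ρ ^ 2 * M) =
      bracket μ α β h t (fun ρ : Fin (2 * n) → Config (N + M) =>
        N * siteOverlap (Fin.castAdd M : Fin N → Fin (N + M)) ρ ^ 2 +
        M * siteOverlap (Fin.natAdd N : Fin M → Fin (N + M)) ρ ^ 2) := by
    congr 1
    funext ρ
    have a1 : q ρ = siteOverlap (Fin.castAdd M : Fin N → Fin (N + M)) ρ := rfl
    have a2 : qTilde ρ = siteOverlap (Fin.natAdd N : Fin M → Fin (N + M)) ρ := rfl
    rw [a1, a2]
    ring
  have e2 : bracket μ α β h t (fun ρ : Fin (2 * n) → Config (N + M) =>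
        (q ρ * N) ^ 2 + 2 * (q ρ * N) * (qTilde ρ * M) + (qTilde ρ * M) ^ 2) =
      bracket μ α β h t (fun ρ : Fin (2 * n) → Config (N + M) =>
        ((N + M : ℕ) : ℝ) ^ 2 * siteOverlap (id : Fin (N + M) → Fin (N + M)) ρ ^ 2) := by
    congr 1
    funext ρ
    have a1 : q ρ * N = ∑ i, ∏ a, spin (ρ a) (Fin.castAdd M i) := by
      simp only [q, multiOverlap, spin, cavity]
      field_simp
    have a2 : qTilde ρ * M = ∑ i, ∏ a, spin (ρ a) (Fin.natAdd N i) := by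
      simp only [qTilde, multiOverlap, spin, added]
      field_simp
    have a3 : ((N + M : ℕ) : ℝ) * siteOverlap (id : Fin (N + M) → Fin (N + M)) ρ =
        q ρ * N + qTilde ρ * M := by
      rw [a1, a2, siteOverlap, ← mul_assoc, mul_one_div_cancel (by push_cast; exact hNM), one_mul,
        Fin.sum_univ_add]
      rfl
    rw [← mul_pow, a3]
    ring
  rw [B, e1, e2, bracket_const_mul, bracket_add, bracket_const_mul, bracket_const_mul]
  push_cast
  field_simp
  ring

theorem rates_eq (N M : ℕ) (α t : ℝ) :
    rates N M α t = ((0, α * N, α * M) : ℝ × ℝ × ℝ) +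
      t • ((α * (N + M : ℕ), -(α * N), -(α * M)) : ℝ × ℝ × ℝ) := by
  simp only [rates, Prod.smul_mk, Prod.mk_add_mk, smul_eq_mul]
  refine Prod.ext ?_ (Prod.ext ?_ ?_) <;> simp only <;> ring

theorem integral_interpLaw_eq_tsum {α t : ℝ} (hα : 0 ≤ α) (ht : t ∈ Icc (0 : ℝ) 1)
    {f : InterpDisorder N M → ℝ} (hf : Integrable f (interpLaw μ N M α t)) :
    ∫ ω, f ω ∂(interpLaw μ N M α t) =
      ∑' i, poissonWeight3 (rates N M α t) i *
        ∫ s, f (zipDisorder (i, s)) ∂(seq3Law μ N M) := by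
  have h1 : 0 ≤ 1 - t := sub_nonneg.2 ht.2
  have h0 := ht.1
  rw [(integral_interpLaw hf).2, integral_countsLaw _ _ _ (integral_interpLaw hf).1]
  all_goals simp only [rates]; positivity

/-- The derivative of the interpolating function. -/
def interpDeriv (μ : Measure ℝ) [IsProbabilityMeasure μ] (N M : ℕ) [NeZero N] [NeZero M]
    (α β h t : ℝ) : ℝ :=
  α * (N + M : ℕ) * ∫ ω, linkGain μ β h (id : Fin (N + M) → Fin (N + M)) ω ∂(interpLaw μ N M α t)
  - α * N * ∫ ω, linkGain μ β h (Fin.castAdd M : Fin N → Fin (N + M)) ω ∂(interpLaw μ N M α t)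
  - α * M * ∫ ω, linkGain μ β h (Fin.natAdd N : Fin M → Fin (N + M)) ω ∂(interpLaw μ N M α t)

theorem hasDerivWithinAt_Phi (hint : Integrable (fun x : ℝ => x) μ) {α β h : ℝ} (hα : 0 ≤ α)
    (hβ : 0 ≤ β) (hh : 0 ≤ h) {t : ℝ} (ht : t ∈ Icc (0 : ℝ) 1) :
    HasDerivWithinAt (fun s => Phi μ N M α β h s) (interpDeriv μ N M α β h t) (Icc 0 1) t := by
  obtain ⟨C, hC⟩ := exists_abs_fixedCountPhi_le (μ := μ) (N := N) (M := M) hint hβ hh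
  -- The identity is confined to [0,1]: outside, rates may be negative and `toNNReal` truncates
  -- them. The two-sided derivative of the series therefore gives a derivative of `Phi` within
  -- [0,1].
  have hPhi : ∀ s ∈ Icc (0 : ℝ) 1, Phi μ N M α β h s =
      ∑' i, poissonWeight3 (((0, α * N, α * M) : ℝ × ℝ × ℝ) +
        s • ((α * (N + M : ℕ), -(α * N), -(α * M)) : ℝ × ℝ × ℝ)) i *
          fixedCountPhi μ N M β h i := fun s hs => by
    rw [← rates_eq]
    exact integral_interpLaw_eq_tsum hα hs (integrable_log_interpZ hint hβ hh N M α s)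
  have hd := (hasDerivAt_tsum_poissonWeight3 hC ((0, α * N, α * M) : ℝ × ℝ × ℝ)
    ((α * (N + M : ℕ), -(α * N), -(α * M)) : ℝ × ℝ × ℝ) t).hasDerivWithinAt (s := Icc 0 1)
  refine (hd.congr hPhi (hPhi t ht)).congr_deriv ?_
  set P := interpLaw μ N M α t
  have g1 := integrable_linkGain hint (h := h) hβ (id : Fin (N + M) → Fin (N + M)) P
  have g2 := integrable_linkGain hint (h := h) hβ (Fin.castAdd M : Fin N → Fin (N + M)) P
  have g3 := integrable_linkGain hint (h := h) hβ (Fin.natAdd N : Fin M → Fin (N + M)) P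
  rw [← rates_eq, interpDeriv, integral_interpLaw_eq_tsum hα ht g1,
    integral_interpLaw_eq_tsum hα ht g2, integral_interpLaw_eq_tsum hα ht g3]
  simp only [← fixedCountPhi_incFst_sub hint hβ hh, ← fixedCountPhi_incSnd_sub hint hβ hh,
    ← fixedCountPhi_incThd_sub hint hβ hh, mul_sub, mul_add]
  have h0 := (summable_poissonWeight3_mul hC (rates N M α t)).hasSum
  have s1 := (summable_poissonWeight3_mul (abs_comp_le_expGrowth hC _ expGrowth_incFst)
    (rates N M α t)).hasSum
  have s2 := (summable_poissonWeight3_mul (abs_comp_le_expGrowth hC _ expGrowth_incSnd)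
    (rates N M α t)).hasSum
  have s3 := (summable_poissonWeight3_mul (abs_comp_le_expGrowth hC _ expGrowth_incThd)
    (rates N M α t)).hasSum
  rw [(s1.sub h0).tsum_eq, (s2.sub h0).tsum_eq, (s3.sub h0).tsum_eq]
  have hs := (((s1.sub h0).mul_left (α * (N + M : ℕ))).sub ((s2.sub h0).mul_left (α * N))).sub
    ((s3.sub h0).mul_left (α * M))
  rw [← hs.tsum_eq]
  refine tsum_congr fun i => ?_
  ring

/-- In the combination with weights N+M, -N and -M, the common constant `∫ linkLog β 0` cancels. -/
theorem hasSum_interpDeriv (hsymm : μ.map (fun x : ℝ => -x) = μ)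
    (hint : Integrable (fun x : ℝ => x) μ) {α β h : ℝ} (hβ : 0 ≤ β) (t : ℝ) :
    HasSum (fun k : ℕ => -α * (tanhCoeff μ β k * B μ N M α β h (k + 1) t))
      (interpDeriv μ N M α β h t) := by
  have h1 := hasSum_integral_linkGain (N := N) (M := M) hsymm hint (h := h) hβ
    (id : Fin (N + M) → Fin (N + M)) α t
  have h2 := hasSum_integral_linkGain (N := N) (M := M) hsymm hint (h := h) hβ
    (Fin.castAdd M : Fin N → Fin (N + M)) α t
  have h3 := hasSum_integral_linkGain (N := N) (M := M) hsymm hint (h := h) hβ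
    (Fin.natAdd N : Fin M → Fin (N + M)) α t
  have hs := (((h1.mul_left ((N + M : ℕ) : ℝ)).sub (h2.mul_left (N : ℝ))).sub
    (h3.mul_left (M : ℝ))).mul_left (-α)
  convert! hs using 1
  · funext k
    rw [B_eq_siteOverlap]
    ring
  · rw [interpDeriv]
    push_cast
    ring

theorem interpDeriv_series (hsymm : μ.map (fun x : ℝ => -x) = μ)
    (hint : Integrable (fun x : ℝ => x) μ) {α β h : ℝ} (hα : 0 ≤ α) (hβ : 0 ≤ β) (t : ℝ) :
    HasSum (fun k : ℕ => -α * (tanhMoment μ β (k + 1) / (2 * ((k : ℝ) + 1)) *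
      B μ N M α β h (k + 1) t)) (interpDeriv μ N M α β h t) ∧
    HasSum (fun k : ℕ => α * (1 / (2 * ((k : ℝ) + 1)) * tanhMoment μ β (k + 1) *
      ((N : ℝ) * M / (N + M) * overlapDist μ N M α β h (k + 1) t)))
      (interpDeriv μ N M α β h t) ∧ 0 ≤ interpDeriv μ N M α β h t := by
  have h1 := hasSum_interpDeriv (N := N) (M := M) (α := α) (h := h) hsymm hint hβ t
  have h2 : HasSum (fun k : ℕ => α * (1 / (2 * ((k : ℝ) + 1)) * tanhMoment μ β (k + 1) *
      ((N : ℝ) * M / (N + M) * overlapDist μ N M α β h (k + 1) t)))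
      (interpDeriv μ N M α β h t) := by
    convert! h1 using 1
    funext k
    rw [B_eq_neg_overlapDist, tanhCoeff]
    ring
  refine ⟨h1, h2, h2.nonneg fun k => ?_⟩
  have a1 := tanhMoment_nonneg (μ := μ) β (k + 1)
  have a2 := overlapDist_nonneg (μ := μ) (N := N) (M := M) α β h (k + 1) t
  positivity

theorem Phi_zero_le_Phi_one (hsymm : μ.map (fun x : ℝ => -x) = μ)
    (hint : Integrable (fun x : ℝ => x) μ) {α β h : ℝ} (hα : 0 ≤ α) (hβ : 0 ≤ β) (hh : 0 ≤ h) :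
    Phi μ N M α β h 0 ≤ Phi μ N M α β h 1 := by
  have hd := fun t ht => hasDerivWithinAt_Phi (μ := μ) (N := N) (M := M) hint hα hβ hh (t := t) ht
  have hmono : MonotoneOn (fun s => Phi μ N M α β h s) (Icc 0 1) := by
    refine monotoneOn_of_deriv_nonneg (convex_Icc 0 1)
      (fun t ht => (hd t ht).continuousWithinAt)
      (fun t ht => (hd t (interior_subset ht)).differentiableWithinAt.mono interior_subset)
      fun t ht => ?_
    rw [((hd t (interior_subset ht)).hasDerivAt (mem_interior_iff_mem_nhds.1 ht)).deriv]
    exact (interpDeriv_series hsymm hint hα hβ t).2.2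
  exact hmono (left_mem_Icc.2 zero_le_one) (right_mem_Icc.2 zero_le_one) zero_le_one

end

/-! ### End points of the interpolation -/

theorem ae_fst_eq_zero (μ : Measure ℝ) [IsProbabilityMeasure μ] (K : ℕ) [NeZero K] :
    ∀ᵐ ω ∂(disorderLaw μ K 0), ω.1 = 0 := by
  have h : ∀ᵐ n ∂(poissonMeasure (0 : ℝ).toNNReal), n = 0 := by
    rw [ae_iff_of_countable]
    intro n hn
    by_contra h0
    rw [poissonMeasure_singleton] at hn
    simp [h0] at hn
  exact Measure.quasiMeasurePreserving_fst.ae h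

theorem hamiltonian_of_fst_eq_zero {K : ℕ} {ω : Disorder K} (h : ω.1 = 0) (σ : Config K) :
    hamiltonian ω σ = 0 := by
  simp [hamiltonian, h]

theorem extHamiltonian_eq_add {N M : ℕ} (h : ℝ) (ρ : Config (N + M)) :
    extHamiltonian h ρ = extHamiltonian h (cavity ρ) + extHamiltonian h (added ρ) := by
  simp only [extHamiltonian, Fin.sum_univ_add, mul_add]
  rfl

/-- Without joint links the energy is a sum over the two blocks, since the field term splits too, so
the partition function factors. -/
theorem interpZ_of_fst_eq_zero {N M : ℕ} (β h : ℝ) {ω : InterpDisorder N M} (h0 : ω.1.1 = 0) :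
    interpZ β h ω = partitionFn β h ω.2.1 * partitionFn β h ω.2.2 := by
  unfold interpZ partitionFn
  rw [Finset.sum_mul_sum, ← Fintype.sum_prod_type', ← (Fin.appendEquiv N M).sum_comp]
  refine Finset.sum_congr rfl fun p _ => ?_
  have a1 : cavity (Fin.appendEquiv N M p) = p.1 := by
    funext i; simp [cavity, Fin.appendEquiv]
  have a2 : added (Fin.appendEquiv N M p) = p.2 := by
    funext i; simp [added, Fin.appendEquiv]
  rw [← Real.exp_add, interpHamiltonian, extHamiltonian_eq_add, hamiltonian_of_fst_eq_zero h0,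
    a1, a2]
  congr 1
  ring

theorem interpZ_of_snd_eq_zero {N M : ℕ} (β h : ℝ) {ω : InterpDisorder N M} (h1 : ω.2.1.1 = 0)
    (h2 : ω.2.2.1 = 0) : interpZ β h ω = partitionFn β h ω.1 := by
  simp only [interpZ, partitionFn, interpHamiltonian, hamiltonian_of_fst_eq_zero h1,
    hamiltonian_of_fst_eq_zero h2, add_zero]

section
variable {μ : Measure ℝ} [IsProbabilityMeasure μ] {N M : ℕ} [NeZero N] [NeZero M]

theorem Phi_zero (hint : Integrable (fun x : ℝ => x) μ) {α β h : ℝ} (hβ : 0 ≤ β) (hh : 0 ≤ h) :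
    Phi μ N M α β h 0 = meanLogZ μ α β h N + meanLogZ μ α β h M := by
  have hl : interpLaw μ N M α 0 = (disorderLaw μ (N + M) 0).prod
      ((disorderLaw μ N (α * N)).prod (disorderLaw μ M (α * M))) := by
    simp [interpLaw]
  have i1 := (integrable_log_partitionFn hint hβ hh N (α * N)).comp_fst (disorderLaw μ M (α * M))
  have i2 := (integrable_log_partitionFn hint hβ hh M (α * M)).comp_snd (disorderLaw μ N (α * N))
  rw [Phi, hl]
  have hae : ∀ᵐ ω ∂((disorderLaw μ (N + M) 0).prod
      ((disorderLaw μ N (α * N)).prod (disorderLaw μ M (α * M)))),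
      Real.log (interpZ β h ω) =
        (fun p : Disorder N × Disorder M => Real.log (partitionFn β h p.1) +
          Real.log (partitionFn β h p.2)) ω.2 := by
    filter_upwards [Measure.quasiMeasurePreserving_fst.ae (ae_fst_eq_zero μ (N + M))] with ω hω
    rw [interpZ_of_fst_eq_zero β h hω,
      Real.log_mul (partitionFn_pos β h _).ne' (partitionFn_pos β h _).ne']
  rw [integral_congr_ae hae, integral_fun_snd (fun p : Disorder N × Disorder M =>
    Real.log (partitionFn β h p.1) + Real.log (partitionFn β h p.2)), integral_add i1 i2,
    integral_fun_fst (fun ω => Real.log (partitionFn β h ω)),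
    integral_fun_snd (fun ω => Real.log (partitionFn β h ω))]
  simp [meanLogZ]

theorem Phi_one {α β h : ℝ} : Phi μ N M α β h 1 = meanLogZ μ α β h (N + M) := by
  have hl : interpLaw μ N M α 1 = (disorderLaw μ (N + M) (α * (N + M : ℕ))).prod
      ((disorderLaw μ N 0).prod (disorderLaw μ M 0)) := by
    simp [interpLaw]
  rw [Phi, hl]
  have hae : ∀ᵐ ω ∂((disorderLaw μ (N + M) (α * (N + M : ℕ))).prod
      ((disorderLaw μ N 0).prod (disorderLaw μ M 0))),
      Real.log (interpZ β h ω) = (fun p => Real.log (partitionFn β h p)) ω.1 := by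
    filter_upwards [Measure.quasiMeasurePreserving_snd.ae
      (Measure.quasiMeasurePreserving_fst.ae (ae_fst_eq_zero μ N)),
      Measure.quasiMeasurePreserving_snd.ae
      (Measure.quasiMeasurePreserving_snd.ae (ae_fst_eq_zero μ M))] with ω h1 h2
    rw [interpZ_of_snd_eq_zero β h h1 h2]
  rw [integral_congr_ae hae, integral_fun_fst (fun p => Real.log (partitionFn β h p))]
  simp [meanLogZ]

/-! ### Superadditivity and the thermodynamic limit -/

theorem meanLogZ_superadditive (hsymm : μ.map (fun x : ℝ => -x) = μ)
    (hint : Integrable (fun x : ℝ => x) μ) {α β h : ℝ} (hα : 0 ≤ α) (hβ : 0 ≤ β) (hh : 0 ≤ h) :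
    meanLogZ μ α β h N + meanLogZ μ α β h M ≤ meanLogZ μ α β h (N + M) := by
  rw [← Phi_zero hint hβ hh, ← Phi_one]
  exact Phi_zero_le_Phi_one hsymm hint hα hβ hh

/-- The expected number of links is αK, so the mean total absolute coupling is linear in `K`. This
bound makes the limit in Fekete's lemma finite. -/
theorem meanLogZ_le (hint : Integrable (fun x : ℝ => x) μ) {α β h : ℝ} (hα : 0 ≤ α)
    (hβ : 0 ≤ β) (hh : 0 ≤ h) (K : ℕ) [NeZero K] :
    meanLogZ μ α β h K ≤ (Real.log 2 + β * (α * ∫ x, |x| ∂μ + h)) * K := by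
  have i1 := integrable_absCoupling hint K (α * K)
  have i2 : Integrable (fun ω => absCoupling ω + h * K) (disorderLaw μ K (α * K)) :=
    i1.add (integrable_const (h * K))
  have h1 : meanLogZ μ α β h K ≤ ∫ ω : Disorder K, (K * Real.log 2 +
      β * (absCoupling ω + h * K)) ∂(disorderLaw μ K (α * K)) :=
    integral_mono (integrable_log_partitionFn hint hβ hh K _)
      ((integrable_const _).add (i2.const_mul β))
      fun ω => (le_abs_self _).trans (abs_log_partitionFn_le hβ hh ω)
  refine h1.trans_eq ?_
  rw [integral_add (integrable_const _) (i2.const_mul β), integral_const_mul β,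
    integral_add i1 (integrable_const _), integral_absCoupling hint K (by positivity)]
  simp only [integral_const, probReal_univ, smul_eq_mul, one_mul]
  ring

theorem exists_tendsto_meanLogZ (hsymm : μ.map (fun x : ℝ => -x) = μ)
    (hint : Integrable (fun x : ℝ => x) μ) {α β h : ℝ} (hα : 0 ≤ α) (hβ : 0 ≤ β) (hh : 0 ≤ h) :
    ∃ p : ℝ, Tendsto (fun n : ℕ => meanLogZ μ α β h (n + 1) / ((n + 1 : ℕ) : ℝ)) atTop (𝓝 p) := by
  -- Fekete's lemma needs a sequence on all of ℕ, whereas `meanLogZ` requires a nonzero size; the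
  -- value 0 at 0 preserves subadditivity.
  let u : ℕ → ℝ := fun n => match n with
    | 0 => 0
    | n + 1 => -meanLogZ μ α β h (n + 1)
  have hu : Subadditive u := by
    rintro (_ | m) (_ | n)
    · simp [u]
    · simp [u]
    · simp [u]
    · have : meanLogZ μ α β h (m + 1) + meanLogZ μ α β h (n + 1) ≤
          meanLogZ μ α β h (m + 1 + n + 1) := meanLogZ_superadditive hsymm hint hα hβ hh
      change -meanLogZ μ α β h (m + 1 + n + 1) ≤
        -meanLogZ μ α β h (m + 1) + -meanLogZ μ α β h (n + 1)
      linarith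
  have hbdd : BddBelow (range fun n => u n / n) := by
    -- The minimum with 0 accounts for the index 0, where the quotient is 0 / 0 = 0.
    refine ⟨min 0 (-(Real.log 2 + β * (α * ∫ x, |x| ∂μ + h))), ?_⟩
    rintro _ ⟨_ | n, rfl⟩
    · simp [u]
    · refine (min_le_right _ _).trans ?_
      have := meanLogZ_le (μ := μ) hint hα hβ hh (n + 1)
      change _ ≤ -meanLogZ μ α β h (n + 1) / ((n + 1 : ℕ) : ℝ)
      rw [le_div_iff₀ (by positivity)]
      linarith
  refine ⟨-hu.lim, ?_⟩
  have := ((tendsto_add_atTop_iff_nat 1).2 (hu.tendsto_lim hbdd)).neg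
  refine this.congr fun n => ?_
  change -(-meanLogZ μ α β h (n + 1) / ((n + 1 : ℕ) : ℝ)) = _
  ring

end
end VianaBray

end

theorem mainTheorem4 (μ : Measure ℝ) [IsProbabilityMeasure μ]
    (hsymm : μ.map (fun x : ℝ => -x) = μ) (hint : Integrable (fun x : ℝ => x) μ)
    (α β h : ℝ) (hα : 0 ≤ α) (hβ : 0 ≤ β) (hh : 0 ≤ h) :
    -- the interpolation, its derivative, and superadditivity, for all sizes
    (∀ (N M : ℕ) [NeZero N] [NeZero M],
      (∀ t ∈ Icc (0 : ℝ) 1,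
        Integrable (fun ω => Real.log (VianaBray.interpZ β h ω))
          (VianaBray.interpLaw μ N M α t)) ∧
      VianaBray.Phi μ N M α β h 0
        = VianaBray.meanLogZ μ α β h N + VianaBray.meanLogZ μ α β h M ∧
      VianaBray.Phi μ N M α β h 1 = VianaBray.meanLogZ μ α β h (N + M) ∧
      (∀ t ∈ Icc (0 : ℝ) 1, ∃ D : ℝ,
        HasDerivWithinAt (fun s => VianaBray.Phi μ N M α β h s) D (Icc 0 1) t ∧
        HasSum (fun k : ℕ => -α * (VianaBray.tanhMoment μ β (k + 1) / (2 * ((k : ℝ) + 1)) *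
          VianaBray.B μ N M α β h (k + 1) t)) D ∧
        HasSum (fun k : ℕ => α * (1 / (2 * ((k : ℝ) + 1)) * VianaBray.tanhMoment μ β (k + 1) *
          ((N : ℝ) * M / (N + M) * VianaBray.overlapDist μ N M α β h (k + 1) t))) D ∧
        0 ≤ D) ∧
      (∀ t ∈ Icc (0 : ℝ) 1, ∀ m : ℕ, ∀ O : (Fin m → VianaBray.Config (N + M)) → ℝ,
        Integrable (fun ω => VianaBray.replicaGibbs β h ω O)
          (VianaBray.interpLaw μ N M α t)) ∧
      (∀ t ∈ Icc (0 : ℝ) 1, ∀ n : ℕ, 1 ≤ n →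
        VianaBray.B μ N M α β h n t
          = -((N : ℝ) * M / (N + M) * VianaBray.overlapDist μ N M α β h n t) ∧
        VianaBray.B μ N M α β h n t ≤ 0) ∧
      VianaBray.meanLogZ μ α β h N + VianaBray.meanLogZ μ α β h M
        ≤ VianaBray.meanLogZ μ α β h (N + M)) ∧
    -- the expectations of `ln Z` exist
    (∀ (K : ℕ) [NeZero K],
      Integrable (fun ω => Real.log (VianaBray.partitionFn β h ω))
        (VianaBray.disorderLaw μ K (α * K))) ∧
    -- the thermodynamic limit
    ∃ p : ℝ,
      Tendsto (fun n : ℕ => VianaBray.meanLogZ μ α β h (n + 1) / ((n + 1 : ℕ) : ℝ))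
        atTop (𝓝 p) ∧
      (0 < β →
        Tendsto (fun n : ℕ => VianaBray.freeEnergy μ α β h (n + 1)) atTop (𝓝 (-p / β))) := by
  refine ⟨fun N M _ _ => ⟨fun t _ => VianaBray.integrable_log_interpZ hint hβ hh N M α t,
    VianaBray.Phi_zero hint hβ hh, VianaBray.Phi_one,
    fun t ht => ⟨VianaBray.interpDeriv μ N M α β h t,
      VianaBray.hasDerivWithinAt_Phi hint hα hβ hh ht,
      VianaBray.interpDeriv_series hsymm hint hα hβ t⟩,
    fun t _ m O => VianaBray.integrable_replicaGibbs β h O _,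
    fun t _ n _ => ⟨VianaBray.B_eq_neg_overlapDist α β h n t, ?_⟩,
    VianaBray.meanLogZ_superadditive hsymm hint hα hβ hh⟩,
    fun K _ => VianaBray.integrable_log_partitionFn hint hβ hh K _, ?_⟩
  · rw [VianaBray.B_eq_neg_overlapDist, neg_nonpos]
    have := VianaBray.overlapDist_nonneg (μ := μ) (N := N) (M := M) α β h n t
    positivity
  · obtain ⟨p, hp⟩ := VianaBray.exists_tendsto_meanLogZ hsymm hint hα hβ hh
    refine ⟨p, hp, fun _ => ?_⟩
    have e : -p / β = -(1 / β) * p := by ring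
    rw [e]
    exact hp.const_mul _
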